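/- **Setting.** Let $T=T[1..n]$, $n\ge 1$, be a string over an ordered alphabet, let $\mathsf{SA}$ be its suffix array (so $T[\mathsf{SA}[1]..n]\prec\dots\prec T[\mathsf{SA}[n]..n]$), and let $L$ be its Burrows–Wheeler transform: $L[i]=T[\mathsf{SA}[i]-1]$ if $\mathsf{SA}[i]\ne 1$ and $L[i]=T[n]$ otherwise. Let $\mathsf{LF}(y)=|\{j\in[1,n] : L[j]<L[y]\}|+|\{j\le y : L[j]=L[y]\}|$. Let $L_1,\dots,L_r$ be the maximal runs of equal characters of $L$, let $p(i)$ be the starting position of $L_i$, and let $X$ be the permutation of $[1,r]$ with $\mathsf{LF}(p(X[1]))<\dots<\mathsf{LF}(p(X[r]))$. The $i$-th block of the partitioned suffix array consists of the positions $[z_i,z_i']$ of $\mathsf{SA}$, where $z_i=\mathsf{LF}(p(X[i]))$ and $z_i'=z_i+|L_{X[i]}|-1$. For $k\in[1,n]$ and $1\le b\le e\le n$, an answer to $\mathsf{RMTQ}(\mathsf{SA},b,e,k)$ is any value $\mathsf{SA}[j]>k$ with $j\in[b,e]$ if there is one, and $-1$ otherwise. The interval $[b,e]$ is in case (B) if no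 block satisfies $z_i<b\le e<z_i'$. Define arrays of length $r$: $Z[i]=z_i$; $M[i]=\max \mathsf{SA}[z_i..z_i']$; the $k$-open array, whose $i$-th entry consists of the smallest position $j$ in the $i$-th block with $\mathsf{SA}[j]>k$ and of the value $\mathsf{SA}[j]$, or of $n+1$ and $-1$ if there is no such $j$; and the $k$-close array, whose $i$-th entry consists of the largest such position $j$ and of $\mathsf{SA}[j]$, or of $0$ and $-1$ if there is no such $j$. The model is the unit-cost word RAM with words of at least $A\lceil\log_2(n+2)\rceil$ bits, where $A\ge 1$ is a fixed integer constant; space is counted in words and includes the memory that queries use, apart from a constant number of registers. A predecessor data structure for a set $S$ answers the queries $\mathsf{pred}(S,x)=|\{y\in S : y\le x\}|$; a range maximum (RMQ) data structure for an array $D$ answers the queries $\max D[i..j]$, $i\le j$. **Lemma.** Fix any predecessor data structure that, on every nonempty set $S\subseteq[1,u]$ with $|S|=m$, takes $O(m)$ words and answers each query $\mathsf{pred}(S,x)$, $x\in[1,u]$, in at most $Q(m,u)$ time (on words of at least $A\lceil\log_2(u+2)\rceil$ bits). Then there is an RMQ data structure that takes $O(m)$ words and $O(1)$ query time on every array of length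 $m\ge 1$ whose length and entries (nonnegative integers) are at most $u$ (again on words of at least $A\lceil\log_2(u+2)\rceil$ bits), such that the following holds for all $T$ and $k\in[1,n]$. The data structure that consists of $Z$, $M$, the $k$-open array, the $k$-close array, the given predecessor data structure on the set of entries of $Z$, and the RMQ data structure on $M$ takes $O(r)$ words in total, and by one fixed program it computes, for every $1\le b\le e\le n$ in case (B), an answer to $\mathsf{RMTQ}(\mathsf{SA},b,e,k)$ in $O(1+Q(r,n))$ time. Each query leaves the structure valid for further queries. The constants depend only on $A$ and on the given predecessor data structure. -/

import Mathlib

/-! ### Unit-cost word RAM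

A word is a `BitVec w`.  The memory of a program consists of a fixed finite family of arrays of
words (indexed by `ι`) and of registers; a program mentions finitely many registers.  Programs do
not depend on the word size `w` nor on the input. -/

/-- The arithmetic, bitwise and comparison instructions of the word RAM. -/
inductive WordOp where
  | add | sub | mul | div | mod | and | or | xor | shl | shr | lt | eq

/-- The effect of an instruction on words: arithmetic modulo `2 ^ w`, unsigned comparison. -/
def WordOp.apply {w : ℕ} : WordOp → BitVec w → BitVec w → BitVec w
  | .add, x, y => x + y
  | .sub, x, y => x - y
  | .mul, x, y => x * y
  | .div, x, y => x / y
  | .mod, x, y => x % y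
  | .and, x, y => x &&& y
  | .or, x, y => x ||| y
  | .xor, x, y => x ^^^ y
  | .shl, x, y => x <<< y
  | .shr, x, y => x >>> y
  | .lt, x, y => if x < y then BitVec.ofNat w 1 else BitVec.ofNat w 0
  | .eq, x, y => if x = y then BitVec.ofNat w 1 else BitVec.ofNat w 0

/-- Word RAM programs over arrays named by `ι`; registers are named by natural numbers. -/
inductive Cmd (ι : Type) where
  | skip
  | const (dst c : ℕ)
  | op (o : WordOp) (dst a b : ℕ)
  | load (dst : ℕ) (arr : ι) (addr : ℕ)
  | store (arr : ι) (addr src : ℕ)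
  | seq (p q : Cmd ι)
  | cond (test : ℕ) (p q : Cmd ι)
  | loop (test : ℕ) (p : Cmd ι)

/-- Contents of the arrays. -/
abbrev Memory (w : ℕ) (ι : Type) := ι → List (BitVec w)

/-- A machine state: registers and arrays. -/
structure RamState (w : ℕ) (ι : Type) where
  reg : ℕ → BitVec w
  mem : Memory w ι

/-- Assignment to a register. -/
def RamState.setReg {w : ℕ} {ι : Type} (s : RamState w ι) (d : ℕ) (v : BitVec w) :
    RamState w ι :=
  { s with reg := Function.update s.reg d v }

open Classical in
/-- Assignment to a cell of an array. -/
noncomputable def RamState.setCell {w : ℕ} {ι : Type} (s : RamState w ι) (a : ι) (i : ℕ)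
    (v : BitVec w) : RamState w ι :=
  { s with mem := Function.update s.mem a ((s.mem a).set i v) }

/-- `Cmd.Run p s t s'`: started in `s`, the program `p` halts after exactly `t` unit-cost steps in
the state `s'`.  Accessing a cell outside an array blocks the machine (there is no `Run`), so
the number of cells that a computation can use is fixed by the initial memory. -/
inductive Cmd.Run {w : ℕ} {ι : Type} :
    Cmd ι → RamState w ι → ℕ → RamState w ι → Prop where
  | skip (s) : Run .skip s 1 s
  | const (s d c) : Run (.const d c) s 1 (s.setReg d (BitVec.ofNat w c))
  | op (s o d a b) : Run (.op o d a b) s 1 (s.setReg d (o.apply (s.reg a) (s.reg b)))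
  | load (s d arr a) (h : (s.reg a).toNat < (s.mem arr).length) :
      Run (.load d arr a) s 1 (s.setReg d ((s.mem arr)[(s.reg a).toNat]))
  | store (s arr a b) (h : (s.reg a).toNat < (s.mem arr).length) :
      Run (.store arr a b) s 1 (s.setCell arr (s.reg a).toNat (s.reg b))
  | seq {p q s s₁ s₂ t₁ t₂} (h₁ : Run p s t₁ s₁) (h₂ : Run q s₁ t₂ s₂) :
      Run (.seq p q) s (t₁ + t₂) s₂
  | condTrue {c p q s s₁ t} (hc : s.reg c ≠ 0) (h : Run p s t s₁) :
      Run (.cond c p q) s (t + 1) s₁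
  | condFalse {c p q s s₁ t} (hc : s.reg c = 0) (h : Run q s t s₁) :
      Run (.cond c p q) s (t + 1) s₁
  | loopDone {c p s} (hc : s.reg c = 0) : Run (.loop c p) s 1 s
  | loopStep {c p s s₁ s₂ t₁ t₂} (hc : s.reg c ≠ 0) (h₁ : Run p s t₁ s₁)
      (h₂ : Run (.loop c p) s₁ t₂ s₂) : Run (.loop c p) s (t₁ + t₂ + 1) s₂

/-! ### Data structures -/

/-- A data structure for instances in `I`: a constant number of arrays, a query program, and for
every word size and instance the memory contents that represent the instance. -/
structure DataStructure (I : Type*) where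
  Arr : Type
  fin : Fintype Arr
  query : Cmd Arr
  Valid : (w : ℕ) → I → Memory w Arr → Prop

/-- The instance `x` has a representation, and all its representations occupy at most
`space` words. -/
def DataStructure.HasSpace {I : Type*} (D : DataStructure I) (w : ℕ) (x : I) (space : ℕ) : Prop :=
  (∃ m, D.Valid w x m) ∧
    ∀ m, D.Valid w x m → (letI := D.fin; ∑ a : D.Arr, (m a).length) ≤ space

/-- Started on any representation of `x`, with the arguments in the registers `0, 1, …` and
arbitrary values in the other registers, the query program halts after at most `time` steps, leaves
in register `0` a value that satisfies `spec` (integers are stored in two's complement), and leaves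
a representation of `x` in memory. -/
def DataStructure.Answers {I : Type*} (D : DataStructure I) (w : ℕ) (x : I) (args : List ℕ)
    (time : ℕ) (spec : ℤ → Prop) : Prop :=
  ∀ s : RamState w D.Arr, D.Valid w x s.mem →
    (∀ (i : ℕ) (h : i < args.length), s.reg i = BitVec.ofNat w args[i]) →
    ∃ (t : ℕ) (s' : RamState w D.Arr), t ≤ time ∧ Cmd.Run D.query s t s' ∧
      D.Valid w x s'.mem ∧ ∃ v : ℤ, spec v ∧ s'.reg 0 = BitVec.ofInt w v

/-- The word size `w` is at least `A` times the number of bits needed for `0, …, u + 1`. -/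
def WordSizeOK (A u w : ℕ) : Prop := A * Nat.clog 2 (u + 2) ≤ w

/-- The number of elements of `S` that are at most `x`. -/
def pred (S : Finset ℕ) (x : ℕ) : ℕ := (S.filter (fun y => y ≤ x)).card

/-- `D` is a predecessor data structure for nonempty sets `S` in a universe `[1, u]`, of at most
`c * |S|` words and with query time at most `Q |S| u`. -/
def IsPredecessorStructure (A c : ℕ) (Q : ℕ → ℕ → ℕ) (D : DataStructure (ℕ × Finset ℕ)) : Prop :=
  ∀ (w u : ℕ) (S : Finset ℕ), S.Nonempty → S ⊆ Finset.Icc 1 u → WordSizeOK A u w →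
    D.HasSpace w (u, S) (c * S.card) ∧
    ∀ x ∈ Finset.Icc 1 u, D.Answers w (u, S) [x] (Q S.card u) (fun v => v = pred S x)

/-- The maximum of `D[i..j]`, for `i ≤ j`. -/
def rmq (D : ℕ → ℕ) (i j : ℕ) : ℕ := (Finset.Icc i j).sup D

/-- `D` is a data structure for range maximum queries on nonempty arrays, of at most `c * m` words
for an array of length `m`, and with query time at most `c`.  Arrays are indexed from `1`. -/
def IsRMQStructure (A c : ℕ) (D : DataStructure (List ℕ)) : Prop :=
  ∀ (w u : ℕ) (a : List ℕ), a ≠ [] → a.length ≤ u → (∀ y ∈ a, y ≤ u) → WordSizeOK A u w →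
    D.HasSpace w a (c * a.length) ∧
    ∀ i j : ℕ, 1 ≤ i → i ≤ j → j ≤ a.length →
      D.Answers w a [i, j] c (fun v => v = rmq (fun l => a.getD (l - 1) 0) i j)

/-! ### Suffix array, BWT, LF function and partitioned suffix array

A string of length `n` is given by `T : ℕ → α`, of which only the characters `T 1, …, T n` are
used.  All arrays are indexed from `1`. -/

section Text

variable {α : Type*} [LinearOrder α] (T : ℕ → α) (n : ℕ)

/-- The suffix `T[i..n]`. -/
def suffix (i : ℕ) : List α := (List.range' i (n + 1 - i)).map T

/-- The suffix array: the positions `1, …, n`, sorted by the lexicographical order of suffixes. -/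
def suffixArray (i : ℕ) : ℕ :=
  ((List.range' 1 n).mergeSort (fun p q => decide (suffix T n p ≤ suffix T n q))).getD (i - 1) 0

/-- The Burrows-Wheeler transform `L` of `T`. -/
def bwt (i : ℕ) : α :=
  if suffixArray T n i ≠ 1 then T (suffixArray T n i - 1) else T n

/-- The LF function: the number of characters of `L` that are smaller than `L[y]`, plus the rank of
`L[y]` in `L[1..y]`. -/
def lf (y : ℕ) : ℕ :=
  ((Finset.Icc 1 n).filter (fun j => bwt T n j < bwt T n y)).card +
    ((Finset.Icc 1 y).filter (fun j => bwt T n j = bwt T n y)).card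

/-- The starting positions of the runs of `L`, in increasing order. -/
def runStarts : List ℕ :=
  (List.range' 1 n).filter (fun y => decide (y = 1 ∨ bwt T n y ≠ bwt T n (y - 1)))

/-- The number `r` of runs of `L`. -/
def numRuns : ℕ := (runStarts T n).length

/-- The starting position of the `i`-th run of `L`; it is `n + 1` for `i = r + 1`. -/
def runStart (i : ℕ) : ℕ := (runStarts T n).getD (i - 1) (n + 1)

/-- The length of the `i`-th run of `L`. -/
def runLength (i : ℕ) : ℕ := runStart T n (i + 1) - runStart T n i

/-- The permutation `X` of `[1, r]` that sorts the runs of `L` by the image of their starting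
position under the LF function. -/
def runOrder (i : ℕ) : ℕ :=
  ((List.range' 1 (numRuns T n)).mergeSort
    (fun x y => decide (lf T n (runStart T n x) ≤ lf T n (runStart T n y)))).getD (i - 1) 0

/-- The first position of the `i`-th subarray of the partitioned suffix array. -/
def blockFirst (i : ℕ) : ℕ := lf T n (runStart T n (runOrder T n i))

/-- The last position of the `i`-th subarray of the partitioned suffix array. -/
def blockLast (i : ℕ) : ℕ := blockFirst T n i + runLength T n (runOrder T n i) - 1

/-- The positions in the `i`-th subarray whose value is larger than `k`. -/
def largePositions (k i : ℕ) : Finset ℕ :=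
  (Finset.Icc (blockFirst T n i) (blockLast T n i)).filter (fun j => k < suffixArray T n j)

/-- The `k`-open position of the `i`-th subarray. -/
def openPos (k i : ℕ) : ℕ :=
  (insert (n + 1) (largePositions T n k i)).min' (Finset.insert_nonempty _ _)

/-- The `k`-close position of the `i`-th subarray. -/
def closePos (k i : ℕ) : ℕ :=
  (insert 0 (largePositions T n k i)).max' (Finset.insert_nonempty _ _)

/-- The value at the `k`-open position, or `-1`. -/
def openVal (k i : ℕ) : ℤ :=
  if openPos T n k i ≠ n + 1 then (suffixArray T n (openPos T n k i) : ℤ) else -1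

/-- The value at the `k`-close position, or `-1`. -/
def closeVal (k i : ℕ) : ℤ :=
  if closePos T n k i ≠ 0 then (suffixArray T n (closePos T n k i) : ℤ) else -1

/-- The maximum value of the `i`-th subarray. -/
def blockMax (i : ℕ) : ℕ := rmq (suffixArray T n) (blockFirst T n i) (blockLast T n i)

/-- The array `f 1, …, f r`. -/
def runArray {β : Type} (f : ℕ → β) : List β := (List.range' 1 (numRuns T n)).map f

/-- Case (A) for `[b, e]`: it lies strictly inside one subarray. -/
def CaseA (b e : ℕ) : Prop :=
  ∃ i ∈ Finset.Icc 1 (numRuns T n), blockFirst T n i < b ∧ e < blockLast T n i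

/-- Case (B) is the complement of case (A). -/
def CaseB (b e : ℕ) : Prop := ¬ CaseA T n b e

end Text

/-- `v` is an answer of the range more than query: a value larger than `k` in `D[b..e]`, or `-1` if
there is none. -/
def IsRMTQAnswer (D : ℕ → ℕ) (b e k : ℕ) (v : ℤ) : Prop :=
  (∃ j ∈ Finset.Icc b e, k < D j ∧ v = D j) ∨ ((∀ j ∈ Finset.Icc b e, D j ≤ k) ∧ v = -1)

/-- The arrays of the case (B) structure besides its two substructures: starting positions of the
subarrays, maximum values, and the two components of the `k`-open and of the `k`-close array. -/
inductive CaseBArr where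
  | start | max | openPos | openVal | closePos | closeVal

instance : DecidableEq CaseBArr := fun x y => by
  cases x <;> cases y <;> first | exact isTrue rfl | exact isFalse (fun h => nomatch h)

instance : Fintype CaseBArr where
  elems := {CaseBArr.start, CaseBArr.max, CaseBArr.openPos, CaseBArr.openVal,
    CaseBArr.closePos, CaseBArr.closeVal}
  complete := by intro x; cases x <;> simp

/-- The case (B) structure for instances `(T, n, k)`: the starting position array, the max value
array, the `k`-open and `k`-close arrays, a predecessor structure `P` for the starting positions,
and an RMQ structure `R` for the max value array; `prog` is the query program. -/
def caseBStructure (α : Type*) [LinearOrder α] (P : DataStructure (ℕ × Finset ℕ))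
    (R : DataStructure (List ℕ)) (prog : Cmd (CaseBArr ⊕ P.Arr ⊕ R.Arr)) :
    DataStructure ((ℕ → α) × ℕ × ℕ) where
  Arr := CaseBArr ⊕ P.Arr ⊕ R.Arr
  fin := letI := P.fin; letI := R.fin; inferInstance
  query := prog
  Valid := fun w x m =>
    let (T, n, k) := x
    m (.inl .start) = runArray T n (fun i => BitVec.ofNat w (blockFirst T n i)) ∧
    m (.inl .max) = runArray T n (fun i => BitVec.ofNat w (blockMax T n i)) ∧
    m (.inl .openPos) = runArray T n (fun i => BitVec.ofNat w (openPos T n k i)) ∧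
    m (.inl .openVal) = runArray T n (fun i => BitVec.ofInt w (openVal T n k i)) ∧
    m (.inl .closePos) = runArray T n (fun i => BitVec.ofNat w (closePos T n k i)) ∧
    m (.inl .closeVal) = runArray T n (fun i => BitVec.ofInt w (closeVal T n k i)) ∧
    P.Valid w (n, (runArray T n (blockFirst T n)).toFinset) (fun a => m (.inr (.inl a))) ∧
    R.Valid w (runArray T n (blockMax T n)) (fun a => m (.inr (.inr a)))

/-! ### Reasoning about word RAM programs -/

/-! The map `lf` is strictly increasing for the lexicographic order on pairs (letter, position), so
it permutes `[1, n]`; inside a run of equal letters it advances by one (`lf_injOn`, `lf_succ`). It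
therefore carries the runs of the transform onto intervals. These are the blocks, and they partition
`[1, n]` (`mem_block_iff`, `exists_block`, `block_unique`). As blocks are numbered from left to
right, the block of a position is the number of block starts up to it, which is one predecessor
query (`pred_blockFirst`).

Let `b` and `e` lie in the blocks `ib ≤ ie`. A value above `k` in a block strictly between them
shows up in the maximum of the block maxima, which is attained inside `[b, e]`. If `ib < ie`, the
part of block `ib` from `b` on has a value above `k` exactly when the close position is at least
`b`, and symmetrically for `ie` and the open position. If `ib = ie`, case (B) forces `b` to be the
first or `e` the last position of the block, so the open or the close position again decides. This
is `exists_between_of_large`.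

The range maximum structure is linear because a sparse table over chunks of logarithmic length has
about `m / log m` columns and `log m` levels, and a chunk is short enough for a bit mask to index a
table of at most `2 * m` cells (`distant_chunks`, `lowestBit_mask`).

The two substructures are known only through their query programs. `Cmd.Run.rename` embeds such a
program into a larger one, on registers and arrays of its own. -/

@[simp] theorem RamState.setReg_reg {w : ℕ} {ι : Type} (s : RamState w ι) (d i : ℕ)
    (v : BitVec w) : (s.setReg d v).reg i = if i = d then v else s.reg i := by
  simp [RamState.setReg, Function.update_apply]

@[simp] theorem RamState.setReg_mem {w : ℕ} {ι : Type} (s : RamState w ι) (d : ℕ)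
    (v : BitVec w) : (s.setReg d v).mem = s.mem := rfl

/-- Started in `s`, the program halts after at most `T` steps in a state that satisfies `Post`. -/
def Cmd.Halts {w : ℕ} {ι : Type} (p : Cmd ι) (s : RamState w ι) (T : ℕ)
    (Post : RamState w ι → Prop) : Prop :=
  ∃ (t : ℕ) (s' : RamState w ι), t ≤ T ∧ Cmd.Run p s t s' ∧ Post s'

/-- Copying a register. -/
def Cmd.mov {ι : Type} (d a : ℕ) : Cmd ι := .op .or d a a

/-- Branching on `a < b`. -/
def Cmd.ifLt {ι : Type} (t a b : ℕ) (p q : Cmd ι) : Cmd ι := .seq (.op .lt t a b) (.cond t p q)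

/-- Branching on `a = b`. -/
def Cmd.ifEq {ι : Type} (t a b : ℕ) (p q : Cmd ι) : Cmd ι := .seq (.op .eq t a b) (.cond t p q)

/-- The maximum of two registers. -/
def Cmd.maxReg {ι : Type} (t d a b : ℕ) : Cmd ι := Cmd.ifLt t a b (.mov d b) (.mov d a)

namespace Cmd.Halts

variable {w : ℕ} {ι : Type} {p q : Cmd ι} {s : RamState w ι} {T T₁ T₂ : ℕ}
  {Post Post₁ : RamState w ι → Prop}

theorem mono (h : p.Halts s T₁ Post) (hT : T₁ ≤ T) : p.Halts s T Post := by
  obtain ⟨t, s', ht, h⟩ := h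
  exact ⟨t, s', ht.trans hT, h⟩

/-- The budget is written `T₂ + T₁` so that a one-step first command leaves `T + 1`: unification
then peels unit steps off a numeral. -/
theorem seq (h₁ : p.Halts s T₁ Post₁) (h₂ : ∀ s', Post₁ s' → q.Halts s' T₂ Post) :
    (Cmd.seq p q).Halts s (T₂ + T₁) Post := by
  obtain ⟨t, s', ht, hr, hp⟩ := h₁
  obtain ⟨t', s'', ht', hr', hp'⟩ := h₂ s' hp
  exact ⟨t + t', s'', by omega, .seq hr hr', hp'⟩

theorem skip (h : Post s) : Cmd.skip.Halts s (T + 1) Post :=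
  ⟨1, s, by omega, .skip s, h⟩

theorem const {d c : ℕ} (h : Post (s.setReg d (BitVec.ofNat w c))) :
    (Cmd.const d c).Halts s (T + 1) Post :=
  ⟨1, _, by omega, .const s d c, h⟩

theorem op {o : WordOp} {d a b : ℕ} {v : BitVec w} (hv : o.apply (s.reg a) (s.reg b) = v)
    (h : Post (s.setReg d v)) : (Cmd.op o d a b).Halts s (T + 1) Post :=
  ⟨1, _, by omega, .op s o d a b, by rw [hv]; exact h⟩

theorem mov {d a : ℕ} {v : BitVec w} (hv : s.reg a = v) (h : Post (s.setReg d v)) :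
    (Cmd.mov d a).Halts s (T + 1) Post :=
  op (by simp [WordOp.apply, hv]) h

/-- The machine addresses by `toNat`, so `i < 2 ^ w` is what makes the register denote the index `i`
itself. -/
theorem load {d a i : ℕ} {arr : ι} {l : List (BitVec w)} {v : BitVec w}
    (hm : s.mem arr = l) (ha : s.reg a = BitVec.ofNat w i) (hw : i < 2 ^ w)
    (hi : l[i]? = some v) (h : Post (s.setReg d v)) :
    (Cmd.load d arr a).Halts s (T + 1) Post := by
  have hn : (s.reg a).toNat = i := by rw [ha, BitVec.toNat_ofNat, Nat.mod_eq_of_lt hw]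
  obtain ⟨hlt, hv⟩ := List.getElem?_eq_some_iff.1 hi
  have hlt' : (s.reg a).toNat < (s.mem arr).length := by rw [hn, hm]; exact hlt
  refine ⟨1, _, by omega, .load s d arr a hlt', ?_⟩
  have : (s.mem arr)[(s.reg a).toNat] = v := by
    rw [← hv]; congr 1
  rw [this]; exact h

theorem seq_const {d c : ℕ} (h : q.Halts (s.setReg d (BitVec.ofNat w c)) T Post) :
    (Cmd.seq (.const d c) q).Halts s (T + 1) Post :=
  seq (T₁ := 1) (const (T := 0) (Post := fun s' => q.Halts s' T Post) h) fun _ h => h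

theorem seq_op {o : WordOp} {d a b : ℕ} {v : BitVec w}
    (hv : o.apply (s.reg a) (s.reg b) = v)
    (h : q.Halts (s.setReg d v) T Post) : (Cmd.seq (.op o d a b) q).Halts s (T + 1) Post :=
  seq (T₁ := 1) (op (T := 0) (Post := fun s' => q.Halts s' T Post) hv h) fun _ h => h

theorem seq_mov {d a : ℕ} {v : BitVec w} (hv : s.reg a = v)
    (h : q.Halts (s.setReg d v) T Post) : (Cmd.seq (.mov d a) q).Halts s (T + 1) Post :=
  seq (T₁ := 1) (mov (T := 0) (Post := fun s' => q.Halts s' T Post) hv h) fun _ h => h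

theorem seq_load {d a i : ℕ} {arr : ι} {l : List (BitVec w)} {v : BitVec w}
    (hm : s.mem arr = l) (ha : s.reg a = BitVec.ofNat w i) (hw : i < 2 ^ w)
    (hi : l[i]? = some v) (h : q.Halts (s.setReg d v) T Post) :
    (Cmd.seq (.load d arr a) q).Halts s (T + 1) Post :=
  seq (T₁ := 1) (load (T := 0) (Post := fun s' => q.Halts s' T Post) hm ha hw hi h)
    fun _ h => h

/-- `BitVec.ofNat w` respects sums and products modulo `2 ^ w`, so no range hypotheses are needed
here, unlike for division, remainder and right shift. -/
theorem seq_add {d a b x y : ℕ} (ha : s.reg a = BitVec.ofNat w x)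
    (hb : s.reg b = BitVec.ofNat w y)
    (h : q.Halts (s.setReg d (BitVec.ofNat w (x + y))) T Post) :
    (Cmd.seq (.op .add d a b) q).Halts s (T + 1) Post :=
  seq_op (by simp [WordOp.apply, ha, hb, BitVec.ofNat_add]) h

theorem seq_mul {d a b x y : ℕ} (ha : s.reg a = BitVec.ofNat w x)
    (hb : s.reg b = BitVec.ofNat w y)
    (h : q.Halts (s.setReg d (BitVec.ofNat w (x * y))) T Post) :
    (Cmd.seq (.op .mul d a b) q).Halts s (T + 1) Post :=
  seq_op (by simp [WordOp.apply, ha, hb, BitVec.ofNat_mul]) h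

theorem seq_sub {d a b x y : ℕ} (ha : s.reg a = BitVec.ofNat w x)
    (hb : s.reg b = BitVec.ofNat w y) (hxy : y ≤ x)
    (h : q.Halts (s.setReg d (BitVec.ofNat w (x - y))) T Post) :
    (Cmd.seq (.op .sub d a b) q).Halts s (T + 1) Post := by
  refine seq_op ?_ h
  obtain ⟨z, rfl⟩ := Nat.exists_eq_add_of_le hxy
  simp [WordOp.apply, ha, hb, BitVec.ofNat_add]

theorem seq_div {d a b x y : ℕ} (ha : s.reg a = BitVec.ofNat w x)
    (hb : s.reg b = BitVec.ofNat w y) (hx : x < 2 ^ w) (hy : y < 2 ^ w)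
    (h : q.Halts (s.setReg d (BitVec.ofNat w (x / y))) T Post) :
    (Cmd.seq (.op .div d a b) q).Halts s (T + 1) Post := by
  refine seq_op ?_ h
  apply BitVec.eq_of_toNat_eq
  simp [WordOp.apply, ha, hb, Nat.mod_eq_of_lt hx, Nat.mod_eq_of_lt hy,
    Nat.mod_eq_of_lt ((Nat.div_le_self x y).trans_lt hx)]

theorem seq_mod {d a b x y : ℕ} (ha : s.reg a = BitVec.ofNat w x)
    (hb : s.reg b = BitVec.ofNat w y) (hx : x < 2 ^ w) (hy : y < 2 ^ w)
    (h : q.Halts (s.setReg d (BitVec.ofNat w (x % y))) T Post) :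
    (Cmd.seq (.op .mod d a b) q).Halts s (T + 1) Post := by
  refine seq_op ?_ h
  apply BitVec.eq_of_toNat_eq
  simp [WordOp.apply, ha, hb, Nat.mod_eq_of_lt hx, Nat.mod_eq_of_lt hy,
    Nat.mod_eq_of_lt ((Nat.mod_le x y).trans_lt hx)]

theorem seq_shr {d a b x y : ℕ} (ha : s.reg a = BitVec.ofNat w x)
    (hb : s.reg b = BitVec.ofNat w y) (hx : x < 2 ^ w) (hy : y < 2 ^ w)
    (h : q.Halts (s.setReg d (BitVec.ofNat w (x >>> y))) T Post) :
    (Cmd.seq (.op .shr d a b) q).Halts s (T + 1) Post := by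
  refine seq_op ?_ h
  apply BitVec.eq_of_toNat_eq
  have : x >>> y < 2 ^ w := by
    rw [Nat.shiftRight_eq_div_pow]
    exact (Nat.div_le_self _ _).trans_lt hx
  simp [WordOp.apply, ha, hb, Nat.mod_eq_of_lt hx, Nat.mod_eq_of_lt hy, Nat.mod_eq_of_lt this]

theorem seq_shl {d a b x y : ℕ} (ha : s.reg a = BitVec.ofNat w x)
    (hb : s.reg b = BitVec.ofNat w y) (hx : x < 2 ^ w) (hy : y < 2 ^ w)
    (h : q.Halts (s.setReg d (BitVec.ofNat w (x * 2 ^ y))) T Post) :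
    (Cmd.seq (.op .shl d a b) q).Halts s (T + 1) Post := by
  refine seq_op ?_ h
  apply BitVec.eq_of_toNat_eq
  simp [WordOp.apply, ha, hb, Nat.mod_eq_of_lt hx, Nat.mod_eq_of_lt hy, Nat.shiftLeft_eq]

theorem cond_true {c : ℕ} (hc : s.reg c ≠ 0) (h : p.Halts s T Post) :
    (Cmd.cond c p q).Halts s (T + 1) Post := by
  obtain ⟨t, s', ht, hr, hp⟩ := h
  exact ⟨t + 1, s', by omega, .condTrue hc hr, hp⟩

theorem cond_false {c : ℕ} (hc : s.reg c = 0) (h : q.Halts s T Post) :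
    (Cmd.cond c p q).Halts s (T + 1) Post := by
  obtain ⟨t, s', ht, hr, hp⟩ := h
  exact ⟨t + 1, s', by omega, .condFalse hc hr, hp⟩

theorem ifLt {t a b x y : ℕ} (hw : 0 < w) (ha : s.reg a = BitVec.ofNat w x)
    (hb : s.reg b = BitVec.ofNat w y) (hx : x < 2 ^ w) (hy : y < 2 ^ w)
    (hp : x < y → p.Halts (s.setReg t (BitVec.ofNat w 1)) T Post)
    (hq : y ≤ x → q.Halts (s.setReg t (BitVec.ofNat w 0)) T Post) :
    (Cmd.ifLt t a b p q).Halts s (T + 2) Post := by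
  by_cases hxy : x < y
  · refine seq_op (v := BitVec.ofNat w 1) ?_ (cond_true ?_ (hp hxy))
    · simp [WordOp.apply, ha, hb, BitVec.lt_def, Nat.mod_eq_of_lt hx, Nat.mod_eq_of_lt hy, hxy]
    · simp [hw.ne']
  · refine seq_op (v := BitVec.ofNat w 0) ?_ (cond_false ?_ (hq (not_lt.1 hxy)))
    · simp [WordOp.apply, ha, hb, BitVec.lt_def, Nat.mod_eq_of_lt hx, Nat.mod_eq_of_lt hy, hxy]
    · simp

theorem ifEq {t a b x y : ℕ} (hw : 0 < w) (ha : s.reg a = BitVec.ofNat w x)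
    (hb : s.reg b = BitVec.ofNat w y) (hx : x < 2 ^ w) (hy : y < 2 ^ w)
    (hp : x = y → p.Halts (s.setReg t (BitVec.ofNat w 1)) T Post)
    (hq : x ≠ y → q.Halts (s.setReg t (BitVec.ofNat w 0)) T Post) :
    (Cmd.ifEq t a b p q).Halts s (T + 2) Post := by
  have key : BitVec.ofNat w x = BitVec.ofNat w y ↔ x = y := by
    rw [← BitVec.toNat_inj, BitVec.toNat_ofNat, BitVec.toNat_ofNat, Nat.mod_eq_of_lt hx,
      Nat.mod_eq_of_lt hy]
  by_cases hxy : x = y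
  · refine seq_op (v := BitVec.ofNat w 1) ?_ (cond_true ?_ (hp hxy))
    · simp [WordOp.apply, ha, hb, hxy]
    · simp [hw.ne']
  · refine seq_op (v := BitVec.ofNat w 0) ?_ (cond_false ?_ (hq hxy))
    · simp only [WordOp.apply, ha, hb, if_neg (mt key.1 hxy)]
    · simp

/-- The test register `t` is overwritten before the copy, hence `a ≠ t` and `b ≠ t`; its final
content `z` is left unspecified. -/
theorem maxReg {t d a b x y : ℕ} (hw : 0 < w) (ha : s.reg a = BitVec.ofNat w x)
    (hb : s.reg b = BitVec.ofNat w y) (hx : x < 2 ^ w) (hy : y < 2 ^ w) (hat : a ≠ t)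
    (hbt : b ≠ t)
    (h : ∀ z, Post ((s.setReg t z).setReg d (BitVec.ofNat w (max x y)))) :
    (Cmd.maxReg t d a b).Halts s (T + 3) Post := by
  refine ifLt hw ha hb hx hy (fun hxy => ?_) (fun hxy => ?_)
  · refine mov (v := BitVec.ofNat w (max x y)) ?_ (h _)
    rw [max_eq_right hxy.le]; simp [hb, hbt]
  · refine mov (v := BitVec.ofNat w (max x y)) ?_ (h _)
    rw [max_eq_left hxy]; simp [ha, hat]

theorem seq_maxReg {t d a b x y : ℕ} (hw : 0 < w) (ha : s.reg a = BitVec.ofNat w x)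
    (hb : s.reg b = BitVec.ofNat w y) (hx : x < 2 ^ w) (hy : y < 2 ^ w) (hat : a ≠ t)
    (hbt : b ≠ t)
    (h : ∀ z, q.Halts ((s.setReg t z).setReg d (BitVec.ofNat w (max x y))) T Post) :
    (Cmd.seq (.maxReg t d a b) q).Halts s (T + 3) Post :=
  seq (T₁ := 3) (maxReg (T := 0) (Post := fun s' => q.Halts s' T Post) hw ha hb hx hy hat hbt h)
    fun _ h => h

end Cmd.Halts

/-! ### Subroutines -/

/-- Renaming of the registers and arrays of a program. -/
def Cmd.rename {ι κ : Type} (f : ℕ → ℕ) (g : ι → κ) : Cmd ι → Cmd κ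
  | .skip => .skip
  | .const d c => .const (f d) c
  | .op o d a b => .op o (f d) (f a) (f b)
  | .load d arr a => .load (f d) (g arr) (f a)
  | .store arr a b => .store (g arr) (f a) (f b)
  | .seq p q => .seq (p.rename f g) (q.rename f g)
  | .cond c p q => .cond (f c) (p.rename f g) (q.rename f g)
  | .loop c p => .loop (f c) (p.rename f g)

/-- The state of a subroutine within the state of the calling program. -/
def RamState.comap {w : ℕ} {ι κ : Type} (f : ℕ → ℕ) (g : ι → κ) (s : RamState w κ) :
    RamState w ι :=
  ⟨fun i => s.reg (f i), fun a => s.mem (g a)⟩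

theorem RamState.comap_setReg {w : ℕ} {ι κ : Type} {f : ℕ → ℕ} (hf : f.Injective) (g : ι → κ)
    (s : RamState w κ) (d : ℕ) (v : BitVec w) :
    (s.setReg (f d) v).comap f g = (s.comap f g).setReg d v := by
  simp only [RamState.comap, RamState.setReg, RamState.mk.injEq, and_true]
  funext i
  simp [Function.update_apply, hf.eq_iff]

theorem RamState.comap_setCell {w : ℕ} {ι κ : Type} (f : ℕ → ℕ) {g : ι → κ} (hg : g.Injective)
    (s : RamState w κ) (a : ι) (i : ℕ) (v : BitVec w) :
    (s.setCell (g a) i v).comap f g = (s.comap f g).setCell a i v := by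
  simp only [RamState.comap, RamState.setCell, RamState.mk.injEq, true_and]
  funext b
  by_cases h : b = a
  · subst h; simp
  · simp [h, hg.ne h]

/-- Two states agree outside the registers and arrays of a subroutine. -/
def RamState.SameOutside {w : ℕ} {ι κ : Type} (f : ℕ → ℕ) (g : ι → κ) (s s' : RamState w κ) :
    Prop :=
  (∀ r, r ∉ Set.range f → s'.reg r = s.reg r) ∧ ∀ a, a ∉ Set.range g → s'.mem a = s.mem a

theorem RamState.SameOutside.trans {w : ℕ} {ι κ : Type} {f : ℕ → ℕ} {g : ι → κ}
    {s s' s'' : RamState w κ} (h : s.SameOutside f g s') (h' : s'.SameOutside f g s'') :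
    s.SameOutside f g s'' :=
  ⟨fun r hr => (h'.1 r hr).trans (h.1 r hr), fun a ha => (h'.2 a ha).trans (h.2 a ha)⟩

theorem RamState.sameOutside_setReg {w : ℕ} {ι κ : Type} (f : ℕ → ℕ) (g : ι → κ)
    (s : RamState w κ) (d : ℕ) (v : BitVec w) : s.SameOutside f g (s.setReg (f d) v) := by
  refine ⟨fun r hr => ?_, fun a _ => rfl⟩
  rw [RamState.setReg_reg, if_neg]
  rintro rfl
  exact hr ⟨d, rfl⟩

theorem RamState.sameOutside_setCell {w : ℕ} {ι κ : Type} (f : ℕ → ℕ) (g : ι → κ)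
    (s : RamState w κ) (a : ι) (i : ℕ) (v : BitVec w) :
    s.SameOutside f g (s.setCell (g a) i v) := by
  refine ⟨fun r _ => rfl, fun b hb => ?_⟩
  simp only [RamState.setCell, Function.update_apply]
  rw [if_neg]
  rintro rfl
  exact hb ⟨a, rfl⟩

/-- Injectivity of `f` and `g` makes a write in the large state visible in the small one at exactly
one register or array, so every step is simulated at equal cost and nothing outside the ranges
changes. -/
theorem Cmd.Run.rename {w : ℕ} {ι κ : Type} {f : ℕ → ℕ} {g : ι → κ} (hf : f.Injective)
    (hg : g.Injective) {p : Cmd ι} {s₀ s₁ : RamState w ι} {t : ℕ} (h : Cmd.Run p s₀ t s₁) :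
    ∀ s : RamState w κ, s.comap f g = s₀ →
      ∃ s', Cmd.Run (p.rename f g) s t s' ∧ s'.comap f g = s₁ ∧ s.SameOutside f g s' := by
  induction h with
  | skip s₀ => exact fun s hs => ⟨s, .skip s, hs, fun _ _ => rfl, fun _ _ => rfl⟩
  | const s₀ d c =>
    rintro s rfl
    exact ⟨_, .const s (f d) c, RamState.comap_setReg hf g s d _,
      RamState.sameOutside_setReg f g s d _⟩
  | op s₀ o d a b =>
    rintro s rfl
    exact ⟨_, .op s o (f d) (f a) (f b), RamState.comap_setReg hf g s d _,
      RamState.sameOutside_setReg f g s d _⟩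
  | load s₀ d arr a h =>
    rintro s rfl
    exact ⟨_, .load s (f d) (g arr) (f a) h, RamState.comap_setReg hf g s d _,
      RamState.sameOutside_setReg f g s d _⟩
  | store s₀ arr a b h =>
    rintro s rfl
    exact ⟨_, .store s (g arr) (f a) (f b) h, RamState.comap_setCell f hg s arr _ _,
      RamState.sameOutside_setCell f g s arr _ _⟩
  | seq _ _ ih₁ ih₂ =>
    intro s hs
    obtain ⟨s', hr, hc, ho⟩ := ih₁ s hs
    obtain ⟨s'', hr', hc', ho'⟩ := ih₂ s' hc
    exact ⟨s'', .seq hr hr', hc', ho.trans ho'⟩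
  | condTrue hc _ ih =>
    rintro s rfl
    obtain ⟨s', hr, h⟩ := ih s rfl
    exact ⟨s', .condTrue hc hr, h⟩
  | condFalse hc _ ih =>
    rintro s rfl
    obtain ⟨s', hr, h⟩ := ih s rfl
    exact ⟨s', .condFalse hc hr, h⟩
  | loopDone hc =>
    rintro s rfl
    exact ⟨s, .loopDone hc, rfl, fun _ _ => rfl, fun _ _ => rfl⟩
  | loopStep hc _ _ ih₁ ih₂ =>
    rintro s rfl
    obtain ⟨s', hr, hc', ho⟩ := ih₁ s rfl
    obtain ⟨s'', hr', hc'', ho'⟩ := ih₂ s' hc'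
    exact ⟨s'', .loopStep hc hr hr', hc'', ho.trans ho'⟩

/-- `Answers` allows arbitrary contents in the non-argument registers, so a subroutine may be called
repeatedly without clearing its registers. -/
theorem DataStructure.Answers.call {I : Type*} {D : DataStructure I} {w : ℕ} {x : I}
    {args : List ℕ} {time : ℕ} {spec : ℤ → Prop} (h : D.Answers w x args time spec) {κ : Type}
    {f : ℕ → ℕ} {g : D.Arr → κ} (hf : f.Injective) (hg : g.Injective) (s : RamState w κ)
    (hm : D.Valid w x (fun a => s.mem (g a)))
    (ha : ∀ (i : ℕ) (h : i < args.length), s.reg (f i) = BitVec.ofNat w args[i]) :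
    (D.query.rename f g).Halts s time fun s' =>
      D.Valid w x (fun a => s'.mem (g a)) ∧ (∃ v : ℤ, spec v ∧ s'.reg (f 0) = BitVec.ofInt w v) ∧
        s.SameOutside f g s' := by
  obtain ⟨t, s', ht, hr, hv, hres⟩ := h (s.comap f g) hm ha
  obtain ⟨s'', hr', rfl, ho⟩ := hr.rename hf hg s rfl
  exact ⟨t, s'', ht, hr', hv, hres, ho⟩

/-- The range goes up to `u + 1` because the default open position is `n + 1`. -/
theorem WordSizeOK.lt_two_pow {A u w x : ℕ} (h : WordSizeOK A u w) (hA : 1 ≤ A)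
    (hx : x ≤ u + 1) : x < 2 ^ w := by
  have h₁ : u + 2 ≤ 2 ^ Nat.clog 2 (u + 2) := Nat.le_pow_clog (by norm_num) _
  have h₂ : Nat.clog 2 (u + 2) ≤ w := (Nat.le_mul_of_pos_left _ hA).trans h
  have h₃ : 2 ^ Nat.clog 2 (u + 2) ≤ 2 ^ w := Nat.pow_le_pow_right (by norm_num) h₂
  omega

theorem WordSizeOK.pos {A u w : ℕ} (h : WordSizeOK A u w) (hA : 1 ≤ A) : 0 < w := by
  have := h.lt_two_pow hA (x := 1) (by omega)
  by_contra h
  simp [Nat.eq_zero_of_not_pos h] at this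

/-! ### Range maximum queries

The array is cut into chunks of logarithmic length.  A query that meets several chunks is answered
from in-chunk suffix and prefix maxima and from a sparse table over the chunks; a query within a
chunk is answered from a bit mask of the positions that dominate everything up to its right end. -/

namespace RangeMax

/-- The length of a chunk. -/
def width (m : ℕ) : ℕ := Nat.log 2 m + 1

theorem width_pos (m : ℕ) : 0 < width m := Nat.succ_pos _

/-- This keeps the lowest-bit table, which has one cell for each mask, linear in `m`. -/
theorem two_pow_width_le {m : ℕ} (hm : m ≠ 0) : 2 ^ width m ≤ 2 * m := by
  rw [width, pow_succ, mul_comm]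
  exact Nat.mul_le_mul_left 2 (Nat.pow_log_le_self 2 hm)

theorem width_le (m : ℕ) : width m ≤ m + 1 := Nat.succ_le_succ (Nat.log_le_self 2 m)

/-- The positions that a query ending in `j` can return: bit `t` says that the position with offset
`t` in the chunk of `j` is at most `j` and carries a maximum of the range from there to `j`. -/
def mask (f : ℕ → ℕ) (B j : ℕ) : ℕ :=
  Nat.ofBits fun t : Fin B =>
    decide (j / B * B + t ≤ j ∧ ∀ q ∈ Finset.Icc (j / B * B + t) j, f q ≤ f (j / B * B + t))

theorem mask_lt (f : ℕ → ℕ) (B j : ℕ) : mask f B j < 2 ^ B := Nat.ofBits_lt_two_pow _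

theorem testBit_mask {f : ℕ → ℕ} {B j t : ℕ} :
    (mask f B j).testBit t = true ↔
      t < B ∧ j / B * B + t ≤ j ∧
        ∀ q ∈ Finset.Icc (j / B * B + t) j, f q ≤ f (j / B * B + t) := by
  by_cases ht : t < B
  · simp [mask, Nat.testBit_ofBits_lt _ _ ht, ht]
  · simp [mask, Nat.testBit_ofBits_ge _ _ (not_lt.1 ht), ht]

/-- The position of the lowest bit that is set. -/
noncomputable def lowestBit (x : ℕ) : ℕ := sInf {t | x.testBit t = true}

/-- The shift discards the positions before `i`. A position `p` that attains the maximum over `[i,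
j]` is marked, so the lowest remaining bit is at `p` or to its left; the position it marks dominates
everything up to `j`, in particular `p`. -/
theorem lowestBit_mask {f : ℕ → ℕ} {B i j : ℕ} (hB : 0 < B) (hij : i ≤ j)
    (hb : i / B = j / B) :
    i + lowestBit (mask f B j >>> (i % B)) ≤ j ∧
      f (i + lowestBit (mask f B j >>> (i % B))) = (Finset.Icc i j).sup f := by
  set S : Set ℕ := {t | (mask f B j >>> (i % B)).testBit t = true} with hS
  have hi : j / B * B + i % B = i := by rw [← hb, mul_comm]; exact Nat.div_add_mod i B
  have memS : ∀ t, t ∈ S ↔ i % B + t < B ∧ i + t ≤ j ∧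
      ∀ q ∈ Finset.Icc (i + t) j, f q ≤ f (i + t) := by
    intro t
    rw [hS, Set.mem_ofPred_eq, Nat.testBit_shiftRight, testBit_mask, ← add_assoc, hi]
  obtain ⟨p, hp, hmax⟩ := Finset.exists_mem_eq_sup (Finset.Icc i j) ⟨i, by simp [hij]⟩ f
  rw [Finset.mem_Icc] at hp
  have hle : ∀ q ∈ Finset.Icc i j, f q ≤ f p := fun q hq => hmax ▸ Finset.le_sup hq
  have hpS : p - i ∈ S := by
    rw [memS, Nat.add_sub_cancel' hp.1]
    refine ⟨?_, hp.2, fun q hq => hle q ?_⟩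
    -- The offset of `p` is less than `B` because `p ≤ j` and `p` lies in the chunk of `j`.
    · have h₁ := Nat.div_add_mod j B
      have h₂ := Nat.mod_lt j hB
      have h₃ : B * (j / B) = j / B * B := mul_comm _ _
      omega
    · rw [Finset.mem_Icc] at hq ⊢
      omega
  have hmem : lowestBit (mask f B j >>> (i % B)) ∈ S := Nat.sInf_mem ⟨_, hpS⟩
  have hlow : lowestBit (mask f B j >>> (i % B)) ≤ p - i := Nat.sInf_le hpS
  obtain ⟨-, h₂, h₃⟩ := (memS _).1 hmem
  refine ⟨h₂, le_antisymm (Finset.le_sup (by rw [Finset.mem_Icc]; omega)) ?_⟩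
  rw [hmax]
  exact h₃ p (by rw [Finset.mem_Icc]; omega)

/-- The maximum from `p` to the end of its chunk. -/
def suffixMax (f : ℕ → ℕ) (B p : ℕ) : ℕ := (Finset.Ico p ((p / B + 1) * B)).sup f

/-- The maximum from the start of the chunk of `p` to `p`. -/
def prefixMax (f : ℕ → ℕ) (B p : ℕ) : ℕ := (Finset.Ico (p / B * B) (p + 1)).sup f

/-- The sparse table over the chunks, of which `B` levels are stored. -/
def sparse (f : ℕ → ℕ) (B p : ℕ) : ℕ :=
  (Finset.Ico (p / B * B) ((p / B + 2 ^ (p % B)) * B)).sup f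

/-- The two ranges may overlap: a maximum is insensitive to repetition. -/
theorem sup_Ico_union (f : ℕ → ℕ) {a b c d : ℕ} (hac : a ≤ c) (hcb : c ≤ b) (hbd : b ≤ d) :
    max ((Finset.Ico a b).sup f) ((Finset.Ico c d).sup f) = (Finset.Ico a d).sup f := by
  rw [← Finset.sup_union]
  congr 1
  ext x
  simp only [Finset.mem_union, Finset.mem_Ico]
  omega

theorem adjacent_chunks {f : ℕ → ℕ} {B i j : ℕ} (hB : 0 < B) (h : i / B + 1 = j / B) :
    max (suffixMax f B i) (prefixMax f B j) = (Finset.Icc i j).sup f := by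
  have h₁ : i ≤ (i / B + 1) * B := by
    have := Nat.lt_div_mul_add (a := i) hB
    rw [add_mul, one_mul]; omega
  have h₂ : j / B * B ≤ j := Nat.div_mul_le_self j B
  rw [suffixMax, prefixMax, ← h, sup_Ico_union f h₁ le_rfl (by rw [h]; omega)]
  rfl

/-- The full chunks between those of `i` and `j` are covered by two windows of `2 ^ l` chunks, one
starting at the first and one ending at the last; they leave no gap since there are fewer than `2 ^
(l + 1)` chunks. The entry for a chunk and a level is stored at chunk `* B +` level, which decodes
because `l < B`. -/
theorem distant_chunks {f : ℕ → ℕ} {B i j l : ℕ} (hB : 0 < B)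
    (hl : 2 ^ l ≤ j / B - (i / B + 1)) (hl' : j / B - (i / B + 1) < 2 ^ (l + 1)) (hlB : l < B) :
    max (max (max (suffixMax f B i) (prefixMax f B j)) (sparse f B ((i / B + 1) * B + l)))
      (sparse f B ((j / B - 2 ^ l) * B + l)) = (Finset.Icc i j).sup f := by
  have hpos : 0 < 2 ^ l := by positivity
  have hdiv : ∀ c, (c * B + l) / B = c := fun c => by
    rw [mul_comm, Nat.mul_add_div hB, Nat.div_eq_of_lt hlB, add_zero]
  have hmod : ∀ c, (c * B + l) % B = l := fun c => by
    rw [mul_comm, Nat.mul_add_mod, Nat.mod_eq_of_lt hlB]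
  rw [pow_succ] at hl'
  have h₀ : 0 ≤ i / B := Nat.zero_le _
  have h₁ : i ≤ (i / B + 1) * B := by
    have := Nat.lt_div_mul_add (a := i) hB
    rw [add_mul, one_mul]; omega
  have h₂ : j / B * B ≤ j := Nat.div_mul_le_self j B
  have h₃ : (i / B + 1) * B ≤ (j / B - 2 ^ l) * B := Nat.mul_le_mul_right _ (by omega)
  have h₄ : (j / B - 2 ^ l) * B ≤ (i / B + 1 + 2 ^ l) * B := Nat.mul_le_mul_right _ (by omega)
  have h₅ : (i / B + 1 + 2 ^ l) * B ≤ j / B * B := Nat.mul_le_mul_right _ (by omega)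
  have h₆ : j / B - 2 ^ l + 2 ^ l = j / B := by omega
  rw [sparse, sparse, hdiv, hmod, hdiv, hmod, h₆, max_assoc, sup_Ico_union f h₃ h₄ h₅,
    max_right_comm, suffixMax, prefixMax, sup_Ico_union f h₁ le_rfl (h₃.trans (h₄.trans h₅)),
    sup_Ico_union f (h₁.trans (h₃.trans (h₄.trans h₅))) le_rfl (by omega)]
  rfl

theorem sup_le_of_le {f : ℕ → ℕ} {u : ℕ} (h : ∀ p, f p ≤ u) (s : Finset ℕ) : s.sup f ≤ u :=
  Finset.sup_le fun p _ => h p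

/-- The arrays of the range maximum structure. -/
inductive Arr where
  | val | mask | ctz | suf | pre | log | sparse | width

instance : Fintype Arr where
  elems := Finset.mk {Arr.val, Arr.mask, Arr.ctz, Arr.suf, Arr.pre, Arr.log, Arr.sparse,
    Arr.width} (by simp)
  complete := by intro x; cases x <;> simp

/-- The number of cells of an array. -/
def size (m : ℕ) : Arr → ℕ
  | .ctz => 2 ^ RangeMax.width m
  | .width => 1
  | _ => m

/-- The cells of an array. -/
noncomputable def cell (f : ℕ → ℕ) (m : ℕ) : Arr → ℕ → ℕ
  | .val => f
  | .mask => RangeMax.mask f (RangeMax.width m)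
  | .ctz => lowestBit
  | .suf => suffixMax f (RangeMax.width m)
  | .pre => prefixMax f (RangeMax.width m)
  | .log => Nat.log 2
  | .sparse => RangeMax.sparse f (RangeMax.width m)
  | .width => fun _ => RangeMax.width m

/-- The query program. -/
def prog : Cmd Arr :=
  .seq (.const 2 1) <| .seq (.op .sub 0 0 2) <| .seq (.op .sub 1 1 2) <|
  .seq (.const 2 0) <| .seq (.load 2 .width 2) <|
  .seq (.op .div 3 0 2) <| .seq (.op .div 4 1 2) <|
  .ifEq 5 3 4
    (.seq (.op .mod 3 0 2) <| .seq (.load 4 .mask 1) <| .seq (.op .shr 4 4 3) <|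
      .seq (.load 4 .ctz 4) <| .seq (.op .add 0 0 4) <| .load 0 .val 0)
    (.seq (.load 0 .suf 0) <| .seq (.load 1 .pre 1) <| .seq (.maxReg 5 0 0 1) <|
      .seq (.const 1 1) <| .seq (.op .add 3 3 1) <|
      .ifEq 5 3 4 .skip
        (.seq (.op .sub 5 4 3) <| .seq (.load 5 .log 5) <| .seq (.op .shl 1 1 5) <|
          .seq (.op .sub 4 4 1) <| .seq (.op .mul 3 3 2) <| .seq (.op .add 3 3 5) <|
          .seq (.load 3 .sparse 3) <| .seq (.op .mul 4 4 2) <| .seq (.op .add 4 4 5) <|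
          .seq (.load 4 .sparse 4) <| .seq (.maxReg 5 0 0 3) <| .maxReg 5 0 0 4))

/-- The range maximum structure. -/
noncomputable def dataStructure : DataStructure (List ℕ) where
  Arr := Arr
  fin := inferInstance
  query := prog
  Valid := fun w a m => m = fun x =>
    (List.range (size a.length x)).map fun i =>
      BitVec.ofNat w (cell (fun p => a.getD p 0) a.length x i)

theorem prog_halts {w u m : ℕ} {f : ℕ → ℕ} {s : RamState w Arr} (hw : ∀ x ≤ u + 1, x < 2 ^ w)
    (hm : m ≠ 0) (hmu : m ≤ u) (hf : ∀ p, f p ≤ u)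
    (hs : s.mem = fun x => (List.range (size m x)).map fun i => BitVec.ofNat w (cell f m x i))
    {i j : ℕ} (hij : i ≤ j) (hj : j < m) (hi' : s.reg 0 = BitVec.ofNat w (i + 1))
    (hj' : s.reg 1 = BitVec.ofNat w (j + 1)) :
    prog.Halts s 40 fun s' => s'.mem = s.mem ∧
      s'.reg 0 = BitVec.ofNat w ((Finset.Icc i j).sup f) := by
  set B := width m with hBdef
  have hB : 0 < B := width_pos m
  have hBw : B < 2 ^ w := hw _ ((width_le m).trans (by omega))
  have hw0 : 0 < w := by
    have := hw 1 (by omega)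
    by_contra h
    simp [Nat.eq_zero_of_not_pos h] at this
  have hcell : ∀ x i, i < size m x →
      ((List.range (size m x)).map fun i => BitVec.ofNat w (cell f m x i))[i]? =
        some (BitVec.ofNat w (cell f m x i)) := by
    intro x i h
    simp [h]
  have hmem : ∀ x, s.mem x = (List.range (size m x)).map fun i =>
      BitVec.ofNat w (cell f m x i) := fun x => by rw [hs]
  -- Masks have `B` bits and must fit in a word; `B ≤ w` follows from `2 ^ Nat.log 2 m ≤ m < 2 ^ w`.
  have h2B : 2 ^ B ≤ 2 ^ w := by
    refine Nat.pow_le_pow_right (by norm_num) ?_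
    have h₁ : 2 ^ Nat.log 2 m < 2 ^ w := (Nat.pow_log_le_self 2 hm).trans_lt (hw _ (by omega))
    exact (Nat.pow_lt_pow_iff_right (by norm_num)).1 h₁
  have hjB : j / B * B ≤ j := Nat.div_mul_le_self j B
  have hdivle : i / B ≤ j / B := Nat.div_le_div_right hij
  have hi₀ : 0 ≤ i / B := Nat.zero_le _
  have hjd : j / B ≤ j := Nat.div_le_self j B
  -- The arguments become 0-based. The chunk length is read from memory since the program cannot
  -- depend on `m`.
  refine .seq_const <| .seq_sub (x := i + 1) (y := 1) (by simp [hi']) (by simp) (by omega) <|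
    .seq_sub (x := j + 1) (y := 1) (by simp [hj']) (by simp) (by omega) <| .seq_const <|
    .seq_load (i := 0) (hmem .width) (by simp) (by simp) (hcell .width 0 (by simp [size])) <|
    .seq_div (x := i) (y := B) (by simp) (by simp [cell, hBdef]) (hw _ (by omega)) hBw <|
    .seq_div (x := j) (y := B) (by simp) (by simp [cell, hBdef]) (hw _ (by omega)) hBw <|
    .ifEq (x := i / B) (y := j / B) hw0 (by simp) (by simp) (hw _ (by omega)) (hw _ (by omega))
      (fun hb => ?_) (fun hb => ?_)
  · obtain ⟨h₁, h₂⟩ := lowestBit_mask (f := f) hB hij hb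
    have h₃ : mask f B j >>> (i % B) < 2 ^ B := by
      rw [Nat.shiftRight_eq_div_pow]
      exact (Nat.div_le_self _ _).trans_lt (mask_lt f B j)
    refine .seq_mod (x := i) (y := B) (by simp) (by simp [cell, hBdef]) (hw _ (by omega)) hBw <|
      .seq_load (i := j) (hmem .mask) (by simp) (hw _ (by omega)) (hcell .mask j hj) <|
      .seq_shr (x := mask f B j) (y := i % B) (by simp [cell, hBdef]) (by simp)
        ((mask_lt f B j).trans_le h2B) ((Nat.mod_lt i hB).trans hBw) <|
      .seq_load (i := mask f B j >>> (i % B)) (hmem .ctz) (by simp) (h₃.trans_le h2B)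
        (hcell .ctz _ h₃) <|
      .seq_add (x := i) (y := lowestBit (mask f B j >>> (i % B))) (by simp)
        (by simp [cell]) <|
      .load (i := i + lowestBit (mask f B j >>> (i % B))) (hmem .val) (by simp)
        (hw _ (by omega)) (hcell .val _ (by simp only [size]; omega)) ⟨by simp, ?_⟩
    simp [cell, h₂]
  · have hlt : i / B + 1 ≤ j / B := by omega
    have hsuf : suffixMax f B i ≤ u := sup_le_of_le hf _
    have hpre : prefixMax f B j ≤ u := sup_le_of_le hf _
    have hsp : ∀ p, sparse f B p ≤ u := fun p => sup_le_of_le hf _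
    refine .seq_load (i := i) (hmem .suf) (by simp) (hw _ (by omega))
        (hcell .suf i (by simp only [size]; omega)) <|
      .seq_load (i := j) (hmem .pre) (by simp) (hw _ (by omega)) (hcell .pre j hj) <|
      .seq_maxReg (x := suffixMax f B i) (y := prefixMax f B j) hw0 (by simp [cell, hBdef])
        (by simp [cell, hBdef]) (hw _ (by omega)) (hw _ (by omega)) (by simp) (by simp)
        fun z => .seq_const <|
      .seq_add (x := i / B) (y := 1) (by simp) (by simp) <|
      .ifEq (x := i / B + 1) (y := j / B) hw0 (by simp) (by simp) (hw _ (by omega))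
        (hw _ (by omega)) (fun h => .skip ⟨by simp, ?_⟩) (fun h => ?_)
    · simp [adjacent_chunks hB h]
    · set c := j / B - (i / B + 1) with hc
      have hc0 : c ≠ 0 := by omega
      have hl : 2 ^ Nat.log 2 c ≤ c := Nat.pow_log_le_self 2 hc0
      have hl' : c < 2 ^ (Nat.log 2 c + 1) := Nat.lt_pow_succ_log_self (by norm_num) c
      have hlB : Nat.log 2 c < B := Nat.lt_succ_of_le (Nat.log_mono_right (by omega))
      -- The `B` table cells of a chunk have the same indices as its positions, so a chunk that ends
      -- before the chunk of `j` has all its levels stored below `m`.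
      have hi₁ : (i / B + 1) * B + Nat.log 2 c < m := by
        have : (i / B + 1 + 1) * B ≤ j / B * B := Nat.mul_le_mul_right _ (by omega)
        rw [add_mul _ 1 B] at this
        omega
      have hi₂ : (j / B - 2 ^ Nat.log 2 c) * B + Nat.log 2 c < m := by
        have h2 : 0 < 2 ^ Nat.log 2 c := by positivity
        have : (j / B - 2 ^ Nat.log 2 c + 1) * B ≤ j / B * B :=
          Nat.mul_le_mul_right _ (by omega)
        rw [add_mul _ 1 B] at this
        omega
      have h1w : 1 < 2 ^ w := hw _ (by omega)
      refine .seq_sub (x := j / B) (y := i / B + 1) (by simp) (by simp) hlt <|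
        .seq_load (i := c) (hmem .log) (by simp [hc]) (hw _ (by omega))
          (hcell .log c (by simp only [size]; omega)) <|
        .seq_shl (x := 1) (y := Nat.log 2 c) (by simp) (by simp [cell]) h1w (hlB.trans hBw) <|
        .seq_sub (x := j / B) (y := 2 ^ Nat.log 2 c) (by simp) (by simp) (by omega) <|
        .seq_mul (x := i / B + 1) (y := B) (by simp) (by simp [cell, hBdef]) <|
        .seq_add (x := (i / B + 1) * B) (y := Nat.log 2 c) (by simp) (by simp [cell]) <|
        .seq_load (i := (i / B + 1) * B + Nat.log 2 c) (hmem .sparse) (by simp)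
          (hw _ (by omega)) (hcell .sparse _ hi₁) <|
        .seq_mul (x := j / B - 2 ^ Nat.log 2 c) (y := B) (by simp) (by simp [cell, hBdef]) <|
        .seq_add (x := (j / B - 2 ^ Nat.log 2 c) * B) (y := Nat.log 2 c) (by simp)
          (by simp [cell]) <|
        .seq_load (i := (j / B - 2 ^ Nat.log 2 c) * B + Nat.log 2 c) (hmem .sparse) (by simp)
          (hw _ (by omega)) (hcell .sparse _ hi₂) <|
        .seq_maxReg (x := max (suffixMax f B i) (prefixMax f B j))
          (y := sparse f B ((i / B + 1) * B + Nat.log 2 c)) hw0 (by simp)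
          (by simp [cell, hBdef]) (hw _ (by omega)) (hw _ ((hsp _).trans (by omega))) (by simp)
          (by simp) fun z₁ =>
        .maxReg (x := max (max (suffixMax f B i) (prefixMax f B j))
            (sparse f B ((i / B + 1) * B + Nat.log 2 c)))
          (y := sparse f B ((j / B - 2 ^ Nat.log 2 c) * B + Nat.log 2 c)) hw0 (by simp)
          (by simp [cell, hBdef]) (hw _ ?_) (hw _ ((hsp _).trans (by omega))) (by simp)
          (by simp) fun z₂ => ⟨by simp, ?_⟩
      · exact (max_le (max_le hsuf hpre) (hsp _)).trans (by omega)
      · rw [← distant_chunks hB hl hl' hlB]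
        simp

theorem rmq_getD (a : List ℕ) {i j : ℕ} (hi : 1 ≤ i) (hij : i ≤ j) :
    rmq (fun l => a.getD (l - 1) 0) i j =
      (Finset.Icc (i - 1) (j - 1)).sup fun p => a.getD p 0 := by
  apply le_antisymm
  · refine Finset.sup_le fun l hl => ?_
    rw [Finset.mem_Icc] at hl
    exact Finset.le_sup (f := fun p => a.getD p 0) (b := l - 1) (by rw [Finset.mem_Icc]; omega)
  · refine Finset.sup_le fun p hp => ?_
    rw [Finset.mem_Icc] at hp
    exact Finset.le_sup (f := fun l => a.getD (l - 1) 0) (b := p + 1)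
      (by rw [Finset.mem_Icc]; omega)

theorem isRMQStructure {A : ℕ} (hA : 1 ≤ A) : IsRMQStructure A 40 dataStructure := by
  intro w u a ha hlen hval hw
  have hm : a.length ≠ 0 := by simpa using ha
  refine ⟨⟨⟨_, rfl⟩, ?_⟩, ?_⟩
  · rintro _ rfl
    have h2 := two_pow_width_le hm
    -- Six arrays of `m` cells, at most `2 * m` cells for the lowest-bit table and one cell for the
    -- width; `40` is dictated by the query time.
    have key : ∑ x : Arr, size a.length x ≤ 40 * a.length := by
      simp only [Finset.sum, Finset.univ, Fintype.elems]
      simp [size]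
      omega
    change ∑ x : Arr, ((List.range (size a.length x)).map _).length ≤ _
    simpa only [List.length_map, List.length_range] using key
  · intro i j hi hij hj s hs hargs
    have h0 : s.reg 0 = BitVec.ofNat w i := hargs 0 (by simp)
    have h1 : s.reg 1 = BitVec.ofNat w j := hargs 1 (by simp)
    have hf : ∀ p, a.getD p 0 ≤ u := by
      intro p
      rw [List.getD_eq_getElem?_getD]
      rcases lt_or_ge p a.length with h | h
      · simpa [h] using hval _ (List.getElem_mem h)
      · simp [h]
    obtain ⟨t, s', ht, hr, hmem, hres⟩ := prog_halts (s := s) (i := i - 1) (j := j - 1)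
      (fun x hx => hw.lt_two_pow hA hx) hm hlen hf hs (by omega) (by omega)
      (by rw [h0]; congr 1; omega) (by rw [h1]; congr 1; omega)
    refine ⟨t, s', ht, hr, hmem.trans hs, _, rfl, ?_⟩
    rw [hres, rmq_getD a hi hij, BitVec.ofInt_natCast]

end RangeMax

/-! ### The partitioned suffix array -/

theorem List.getD_mergeSort_mem {β : Type*} {l : List β} {le : β → β → Bool} {i : ℕ} (d : β)
    (hi : i < l.length) : (l.mergeSort le).getD i d ∈ l := by
  have h : i < (l.mergeSort le).length := by simpa using hi
  rw [List.getD_eq_getElem _ _ h]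
  exact List.mem_mergeSort.1 (List.getElem_mem h)

section Text

variable {α : Type*} [LinearOrder α] {T : ℕ → α} {n : ℕ}

theorem suffixArray_mem {j : ℕ} (hj : j ∈ Finset.Icc 1 n) :
    suffixArray T n j ∈ Finset.Icc 1 n := by
  rw [Finset.mem_Icc] at hj
  have := List.getD_mergeSort_mem (l := List.range' 1 n) (i := j - 1)
    (le := fun p q => decide (suffix T n p ≤ suffix T n q)) 0 (by simp; omega)
  rw [List.mem_range'_1] at this
  rw [suffixArray, Finset.mem_Icc]
  omega

/-! ### The LF function as a permutation -/

theorem lf_lt_of_eq {y y' : ℕ} (h : y < y') (hL : bwt T n y = bwt T n y') :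
    lf T n y < lf T n y' := by
  rw [lf, lf, hL]
  refine Nat.add_lt_add_left (Finset.card_lt_card ?_) _
  rw [Finset.ssubset_iff_of_subset
    (Finset.filter_subset_filter _ (Finset.Icc_subset_Icc_right h.le))]
  exact ⟨y', by simp; omega, by simp; omega⟩

/-- Every position counted for `y` carries a letter smaller than that of `y'`, so it is counted in
the first summand for `y'`; there `y'` also counts itself. -/
theorem lf_lt_of_lt {y y' : ℕ} (hy : y ≤ n) (hy' : 1 ≤ y') (hL : bwt T n y < bwt T n y') :
    lf T n y < lf T n y' := by
  have h₁ : lf T n y ≤ ((Finset.Icc 1 n).filter (fun j => bwt T n j < bwt T n y')).card := by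
    rw [lf, ← Finset.card_union_of_disjoint]
    · refine Finset.card_le_card fun j hj => ?_
      simp only [Finset.mem_union, Finset.mem_filter, Finset.mem_Icc] at hj ⊢
      rcases hj with hj | hj
      · exact ⟨hj.1, hj.2.trans hL⟩
      · exact ⟨⟨hj.1.1, hj.1.2.trans hy⟩, hj.2 ▸ hL⟩
    · rw [Finset.disjoint_left]
      intro j hj hj'
      simp only [Finset.mem_filter] at hj hj'
      exact hj.2.ne hj'.2
  have h₂ : 0 < ((Finset.Icc 1 y').filter (fun j => bwt T n j = bwt T n y')).card :=
    Finset.card_pos.2 ⟨y', by simp [hy']⟩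
  rw [lf.eq_def T n y']
  omega

theorem lf_injOn : Set.InjOn (lf T n) (Finset.Icc 1 n) := by
  intro y hy y' hy' h
  simp only [Finset.coe_Icc, Set.mem_Icc] at hy hy'
  rcases lt_trichotomy (bwt T n y) (bwt T n y') with hL | hL | hL
  · exact absurd h (lf_lt_of_lt hy.2 hy'.1 hL).ne
  · rcases lt_trichotomy y y' with hlt | rfl | hlt
    · exact absurd h (lf_lt_of_eq hlt hL).ne
    · rfl
    · exact absurd h (lf_lt_of_eq hlt hL.symm).ne'
  · exact absurd h (lf_lt_of_lt hy'.2 hy.1 hL).ne'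

theorem lf_mem {y : ℕ} (hy : y ∈ Finset.Icc 1 n) : lf T n y ∈ Finset.Icc 1 n := by
  rw [Finset.mem_Icc] at hy ⊢
  constructor
  · have : 0 < ((Finset.Icc 1 y).filter (fun j => bwt T n j = bwt T n y)).card :=
      Finset.card_pos.2 ⟨y, by simp [hy.1]⟩
    rw [lf]
    omega
  · rw [lf, ← Finset.card_union_of_disjoint]
    · refine (Finset.card_le_card (t := Finset.Icc 1 n) fun j hj => ?_).trans (by simp)
      simp only [Finset.mem_union, Finset.mem_filter, Finset.mem_Icc] at hj ⊢
      omega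
    · rw [Finset.disjoint_left]
      intro j hj hj'
      simp only [Finset.mem_filter] at hj hj'
      exact hj.2.ne hj'.2

theorem exists_lf_eq {j : ℕ} (hj : j ∈ Finset.Icc 1 n) :
    ∃ y ∈ Finset.Icc 1 n, lf T n y = j := by
  have h : (Finset.Icc 1 n).image (lf T n) = Finset.Icc 1 n := by
    refine Finset.eq_of_subset_of_card_le (Finset.image_subset_iff.2 fun y hy => lf_mem hy) ?_
    rw [Finset.card_image_of_injOn lf_injOn]
  rw [← h, Finset.mem_image] at hj
  exact hj

/-- With the letter unchanged, the first count stays the same and the rank gains just the position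
`y + 1`. This is why runs have intervals as images. -/
theorem lf_succ {y : ℕ} (hL : bwt T n (y + 1) = bwt T n y) :
    lf T n (y + 1) = lf T n y + 1 := by
  rw [lf, lf, hL, ← Finset.insert_Icc_right_eq_Icc_add_one (by omega), Finset.filter_insert,
    if_pos hL, Finset.card_insert_of_notMem (by simp), add_assoc]

/-! ### Runs of the transform -/

theorem mem_runStarts {y : ℕ} :
    y ∈ runStarts T n ↔ y ∈ Finset.Icc 1 n ∧ (y = 1 ∨ bwt T n y ≠ bwt T n (y - 1)) := by
  simp [runStarts, List.mem_range'_1]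
  omega

theorem runStarts_pairwise : (runStarts T n).Pairwise (· < ·) :=
  (List.pairwise_lt_range' (s := 1) (n := n)).filter _

theorem runStart_eq_getElem {i : ℕ} (hi : i ∈ Finset.Icc 1 (numRuns T n)) :
    ∃ h : i - 1 < (runStarts T n).length, runStart T n i = (runStarts T n)[i - 1] := by
  rw [Finset.mem_Icc, numRuns] at hi
  have h : i - 1 < (runStarts T n).length := by omega
  exact ⟨h, List.getD_eq_getElem _ _ h⟩

theorem runStart_mem_runStarts {i : ℕ} (hi : i ∈ Finset.Icc 1 (numRuns T n)) :
    runStart T n i ∈ runStarts T n := by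
  obtain ⟨h, heq⟩ := runStart_eq_getElem hi
  rw [heq]
  exact List.getElem_mem h

theorem runStart_mem {i : ℕ} (hi : i ∈ Finset.Icc 1 (numRuns T n)) :
    runStart T n i ∈ Finset.Icc 1 n :=
  (mem_runStarts.1 (runStart_mem_runStarts hi)).1

/-- The out-of-range default closes the last run, which then needs no separate treatment. -/
theorem runStart_numRuns_succ : runStart T n (numRuns T n + 1) = n + 1 := by
  simp [runStart, numRuns]

theorem runStart_lt {i j : ℕ} (hi : 1 ≤ i) (hij : i < j) (hj : j ≤ numRuns T n + 1) :
    runStart T n i < runStart T n j := by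
  have hi' : i ∈ Finset.Icc 1 (numRuns T n) := by rw [Finset.mem_Icc]; omega
  rcases hj.eq_or_lt with rfl | hj
  · have := Finset.mem_Icc.1 (runStart_mem hi')
    rw [runStart_numRuns_succ]
    omega
  · obtain ⟨h, heq⟩ := runStart_eq_getElem hi'
    obtain ⟨h', heq'⟩ := runStart_eq_getElem (T := T) (n := n) (i := j)
      (by rw [Finset.mem_Icc]; omega)
    rw [heq, heq']
    exact List.pairwise_iff_getElem.1 runStarts_pairwise _ _ h h' (by omega)

theorem exists_runStart_eq {y : ℕ} (hy : y ∈ runStarts T n) :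
    ∃ i ∈ Finset.Icc 1 (numRuns T n), runStart T n i = y := by
  obtain ⟨i, hi, rfl⟩ := List.getElem_of_mem hy
  refine ⟨i + 1, by rw [Finset.mem_Icc, numRuns]; omega, ?_⟩
  rw [runStart, Nat.add_sub_cancel, List.getD_eq_getElem _ _ hi]

theorem numRuns_pos (hn : 1 ≤ n) : 1 ≤ numRuns T n := by
  have : 1 ∈ runStarts T n := mem_runStarts.2 ⟨by simpa using hn, Or.inl rfl⟩
  exact List.length_pos_of_mem this

theorem numRuns_le : numRuns T n ≤ n :=
  (List.length_filter_le _ _).trans (by simp)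

theorem runStart_one (hn : 1 ≤ n) : runStart T n 1 = 1 := by
  obtain ⟨i, hi, h⟩ := exists_runStart_eq (T := T) (n := n) (y := 1)
    (mem_runStarts.2 ⟨by simpa using hn, Or.inl rfl⟩)
  rw [Finset.mem_Icc] at hi
  rcases hi.1.eq_or_lt with rfl | hlt
  · exact h
  · have h₁ := runStart_lt (T := T) (n := n) le_rfl hlt (by omega)
    have h₂ := Finset.mem_Icc.1 (runStart_mem (T := T) (n := n) (i := 1)
      (by rw [Finset.mem_Icc]; omega))
    omega

theorem exists_run {y : ℕ} (hy : y ∈ Finset.Icc 1 n) :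
    ∃ x ∈ Finset.Icc 1 (numRuns T n), runStart T n x ≤ y ∧ y < runStart T n (x + 1) := by
  rw [Finset.mem_Icc] at hy
  have hr := numRuns_pos (T := T) (hy.1.trans hy.2)
  -- The run of `y` is the last one that starts at or before `y`.
  set x := Nat.findGreatest (fun x => runStart T n x ≤ y) (numRuns T n) with hx
  have h1 : runStart T n 1 ≤ y := by rw [runStart_one (hy.1.trans hy.2)]; exact hy.1
  have hx1 : 1 ≤ x := Nat.le_findGreatest hr h1
  have hxr : x ≤ numRuns T n := Nat.findGreatest_le _
  refine ⟨x, by rw [Finset.mem_Icc]; omega,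
    Nat.findGreatest_spec (P := fun x => runStart T n x ≤ y) hr h1, ?_⟩
  rcases hxr.eq_or_lt with h | h
  · rw [h, runStart_numRuns_succ]
    omega
  · by_contra hcon
    have := Nat.le_findGreatest (P := fun x => runStart T n x ≤ y) h (not_lt.1 hcon)
    omega

theorem lf_run {x : ℕ} (hx : x ∈ Finset.Icc 1 (numRuns T n)) (d : ℕ)
    (hd : runStart T n x + d < runStart T n (x + 1)) :
    bwt T n (runStart T n x + d) = bwt T n (runStart T n x) ∧
      lf T n (runStart T n x + d) = lf T n (runStart T n x) + d := by
  rw [Finset.mem_Icc] at hx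
  induction d with
  | zero => simp
  | succ d ih =>
    obtain ⟨ihb, ihl⟩ := ih (by omega)
    have hle : runStart T n (x + 1) ≤ n + 1 := by
      rcases hx.2.eq_or_lt with h | h
      · rw [h, runStart_numRuns_succ]
      · have := Finset.mem_Icc.1 (runStart_mem (T := T) (n := n) (i := x + 1)
          (by rw [Finset.mem_Icc]; omega))
        omega
    have hL : bwt T n (runStart T n x + d + 1) = bwt T n (runStart T n x + d) := by
      -- A change of letter here would give a run start strictly between two consecutive run starts.
      by_contra hne
      obtain ⟨z, hz, hzy⟩ := exists_runStart_eq
        (mem_runStarts.2 ⟨Finset.mem_Icc.2 ⟨by omega, by omega⟩, Or.inr hne⟩)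
      rw [Finset.mem_Icc] at hz
      rcases lt_or_ge x z with h | h
      · rcases (Nat.succ_le_of_lt h).eq_or_lt with h' | h'
        · rw [← h'] at hzy
          simp only [Nat.succ_eq_add_one] at hzy
          omega
        · have := runStart_lt (T := T) (n := n) (i := x + 1) (by omega) h' (by omega)
          omega
      · rcases h.eq_or_lt with h' | h'
        · rw [h'] at hzy
          omega
        · have := runStart_lt (T := T) (n := n) hz.1 h' (by omega)
          omega
    rw [← add_assoc]
    exact ⟨hL.trans ihb, by rw [lf_succ hL, ihl, add_assoc]⟩

theorem run_unique {x x' y : ℕ} (hx : x ∈ Finset.Icc 1 (numRuns T n))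
    (hx' : x' ∈ Finset.Icc 1 (numRuns T n)) (h₁ : runStart T n x ≤ y)
    (h₂ : y < runStart T n (x + 1)) (h₁' : runStart T n x' ≤ y)
    (h₂' : y < runStart T n (x' + 1)) : x = x' := by
  have key : ∀ {a b : ℕ}, a ∈ Finset.Icc 1 (numRuns T n) → b ∈ Finset.Icc 1 (numRuns T n) →
      a < b → runStart T n (a + 1) ≤ runStart T n b := by
    intro a b ha hb hab
    rw [Finset.mem_Icc] at ha hb
    rcases (Nat.succ_le_of_lt hab).eq_or_lt with h | h
    · rw [← h]
    · exact (runStart_lt (by omega) h (by omega)).le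
  rcases lt_trichotomy x x' with h | h | h
  · have := key hx hx' h
    omega
  · exact h
  · have := key hx' hx h
    omega

/-! ### Blocks as images of runs -/

theorem runOrder_mem {i : ℕ} (hi : i ∈ Finset.Icc 1 (numRuns T n)) :
    runOrder T n i ∈ Finset.Icc 1 (numRuns T n) := by
  rw [Finset.mem_Icc] at hi
  have := List.getD_mergeSort_mem (l := List.range' 1 (numRuns T n)) (i := i - 1)
    (le := fun x y => decide (lf T n (runStart T n x) ≤ lf T n (runStart T n y))) 0
    (by simp; omega)
  rw [List.mem_range'_1] at this
  rw [runOrder, Finset.mem_Icc]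
  omega

theorem exists_runOrder_eq {x : ℕ} (hx : x ∈ Finset.Icc 1 (numRuns T n)) :
    ∃ i ∈ Finset.Icc 1 (numRuns T n), runOrder T n i = x := by
  rw [Finset.mem_Icc] at hx
  have hmem : x ∈ (List.range' 1 (numRuns T n)).mergeSort
      (fun x y => decide (lf T n (runStart T n x) ≤ lf T n (runStart T n y))) := by
    rw [List.mem_mergeSort, List.mem_range'_1]
    omega
  obtain ⟨i, hi, h⟩ := List.getElem_of_mem hmem
  refine ⟨i + 1, ?_, ?_⟩
  · simp only [List.length_mergeSort, List.length_range'] at hi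
    rw [Finset.mem_Icc]
    omega
  · rw [runOrder, Nat.add_sub_cancel, List.getD_eq_getElem _ _ hi, h]

/-- Sorting gives only the weak inequality; the strict order of the blocks comes later, from their
disjointness. -/
theorem runOrder_lt {i j : ℕ} (hi : 1 ≤ i) (hij : i < j) (hj : j ≤ numRuns T n) :
    runOrder T n i ≠ runOrder T n j ∧ blockFirst T n i ≤ blockFirst T n j := by
  set le : ℕ → ℕ → Bool :=
    fun x y => decide (lf T n (runStart T n x) ≤ lf T n (runStart T n y)) with hle
  set l := (List.range' 1 (numRuns T n)).mergeSort le with hl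
  have hlen : l.length = numRuns T n := by simp [hl]
  have hi' : i - 1 < l.length := by omega
  have hj' : j - 1 < l.length := by omega
  have hxi : runOrder T n i = l[i - 1] := List.getD_eq_getElem _ _ hi'
  have hxj : runOrder T n j = l[j - 1] := List.getD_eq_getElem _ _ hj'
  have hnd : l.Nodup := (List.mergeSort_perm _ _).nodup_iff.2 List.nodup_range'
  have hpw : l.Pairwise fun a b => le a b = true := by
    refine List.pairwise_mergeSort ?_ ?_ _
    · intro a b c
      simp only [hle, decide_eq_true_eq]
      exact le_trans
    · intro a b
      simp only [hle, Bool.or_eq_true, decide_eq_true_eq]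
      exact le_total _ _
  rw [blockFirst, blockFirst, hxi, hxj]
  refine ⟨fun h => ?_, ?_⟩
  · have := (List.Nodup.getElem_inj_iff hnd).1 h
    omega
  · simpa [hle] using List.pairwise_iff_getElem.1 hpw _ _ hi' hj' (by omega)

theorem runOrder_injOn : Set.InjOn (runOrder T n) (Finset.Icc 1 (numRuns T n)) := by
  intro i hi j hj h
  simp only [Finset.coe_Icc, Set.mem_Icc] at hi hj
  rcases lt_trichotomy i j with hij | hij | hij
  · exact absurd h (runOrder_lt hi.1 hij hj.2).1
  · exact hij
  · exact absurd h.symm (runOrder_lt hj.1 hij hi.2).1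

/-- `lf` translates a run, so a block is the image of its run. Through this, covering and
disjointness of the blocks reduce to those of the runs. -/
theorem mem_block_iff {i j : ℕ} (hi : i ∈ Finset.Icc 1 (numRuns T n)) :
    (blockFirst T n i ≤ j ∧ j ≤ blockLast T n i) ↔
      ∃ y ∈ Finset.Icc 1 n, runStart T n (runOrder T n i) ≤ y ∧
        y < runStart T n (runOrder T n i + 1) ∧ lf T n y = j := by
  have hx := runOrder_mem hi
  have hx' := Finset.mem_Icc.1 hx
  have hs := Finset.mem_Icc.1 (runStart_mem hx)
  have hlt := runStart_lt (T := T) (n := n) hx'.1 (Nat.lt_add_one _) (by omega)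
  have hle : runStart T n (runOrder T n i + 1) ≤ n + 1 := by
    rcases hx'.2.eq_or_lt with h | h
    · rw [h, runStart_numRuns_succ]
    · have := runStart_lt (T := T) (n := n) (i := runOrder T n i + 1) (by omega)
        (Nat.succ_lt_succ h) le_rfl
      rw [runStart_numRuns_succ] at this
      exact this.le
  rw [blockLast, blockFirst, runLength]
  constructor
  · rintro ⟨h₁, h₂⟩
    obtain ⟨d, rfl⟩ := Nat.exists_eq_add_of_le h₁
    refine ⟨runStart T n (runOrder T n i) + d, ?_, by omega, by omega,
      (lf_run hx d (by omega)).2⟩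
    rw [Finset.mem_Icc]
    omega
  · rintro ⟨y, -, h₁, h₂, rfl⟩
    obtain ⟨d, rfl⟩ := Nat.exists_eq_add_of_le h₁
    rw [(lf_run hx d h₂).2]
    omega

theorem exists_block {j : ℕ} (hj : j ∈ Finset.Icc 1 n) :
    ∃ i ∈ Finset.Icc 1 (numRuns T n), blockFirst T n i ≤ j ∧ j ≤ blockLast T n i := by
  obtain ⟨y, hy, h⟩ := exists_lf_eq (T := T) hj
  obtain ⟨x, hx, h₁, h₂⟩ := exists_run (T := T) hy
  obtain ⟨i, hi, rfl⟩ := exists_runOrder_eq hx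
  exact ⟨i, hi, (mem_block_iff hi).2 ⟨y, hy, h₁, h₂, h⟩⟩

theorem block_unique {i i' j : ℕ} (hi : i ∈ Finset.Icc 1 (numRuns T n))
    (hi' : i' ∈ Finset.Icc 1 (numRuns T n)) (h : blockFirst T n i ≤ j ∧ j ≤ blockLast T n i)
    (h' : blockFirst T n i' ≤ j ∧ j ≤ blockLast T n i') : i = i' := by
  obtain ⟨y, hy, h₁, h₂, h₃⟩ := (mem_block_iff hi).1 h
  obtain ⟨y', hy', h₁', h₂', h₃'⟩ := (mem_block_iff hi').1 h'
  obtain rfl : y = y' := lf_injOn (by simpa using hy) (by simpa using hy') (h₃.trans h₃'.symm)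
  exact runOrder_injOn (by simpa using hi) (by simpa using hi')
    (run_unique (runOrder_mem hi) (runOrder_mem hi') h₁ h₂ h₁' h₂')

theorem blockFirst_le_blockLast {i : ℕ} (hi : i ∈ Finset.Icc 1 (numRuns T n)) :
    blockFirst T n i ≤ blockLast T n i := by
  have hx := Finset.mem_Icc.1 (runOrder_mem hi)
  have := runStart_lt (T := T) (n := n) hx.1 (Nat.lt_add_one _) (by omega)
  rw [blockLast, runLength]
  omega

theorem mem_of_mem_block {i j : ℕ} (hi : i ∈ Finset.Icc 1 (numRuns T n))
    (h : blockFirst T n i ≤ j ∧ j ≤ blockLast T n i) : j ∈ Finset.Icc 1 n := by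
  obtain ⟨y, hy, -, -, rfl⟩ := (mem_block_iff hi).1 h
  exact lf_mem hy

theorem blockFirst_mem {i : ℕ} (hi : i ∈ Finset.Icc 1 (numRuns T n)) :
    blockFirst T n i ∈ Finset.Icc 1 n :=
  mem_of_mem_block hi ⟨le_rfl, blockFirst_le_blockLast hi⟩

/-- Otherwise the first position of the later block would lie in both blocks. -/
theorem blockLast_lt_blockFirst {i i' : ℕ} (hi : i ∈ Finset.Icc 1 (numRuns T n))
    (hi' : i' ∈ Finset.Icc 1 (numRuns T n)) (h : i < i') :
    blockLast T n i < blockFirst T n i' := by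
  by_contra hcon
  have hle := (runOrder_lt (Finset.mem_Icc.1 hi).1 h (Finset.mem_Icc.1 hi').2).2
  exact h.ne (block_unique hi hi' ⟨hle, not_lt.1 hcon⟩ ⟨le_rfl, blockFirst_le_blockLast hi'⟩)

theorem block_le {i i' j j' : ℕ} (hi : i ∈ Finset.Icc 1 (numRuns T n))
    (hi' : i' ∈ Finset.Icc 1 (numRuns T n)) (h : blockFirst T n i ≤ j)
    (h' : j' ≤ blockLast T n i') (hj : j ≤ j') : i ≤ i' := by
  by_contra hcon
  have := blockLast_lt_blockFirst hi' hi (not_le.1 hcon)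
  omega

theorem blockFirst_injOn : Set.InjOn (blockFirst T n) (Finset.Icc 1 (numRuns T n)) := by
  intro i hi j hj h
  have hi' := blockFirst_le_blockLast (T := T) (n := n) (by simpa using hi)
  have hj' := blockFirst_le_blockLast (T := T) (n := n) (by simpa using hj)
  exact block_unique (by simpa using hi) (by simpa using hj) ⟨le_rfl, hi'⟩ ⟨h.ge, h.trans_le hj'⟩

theorem toFinset_runArray (f : ℕ → ℕ) :
    (runArray T n f).toFinset = (Finset.Icc 1 (numRuns T n)).image f := by
  ext x
  simp only [runArray, List.mem_toFinset, List.mem_map, List.mem_range'_1, Finset.mem_image,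
    Finset.mem_Icc]
  constructor <;> rintro ⟨i, hi, rfl⟩ <;> exact ⟨i, by omega, rfl⟩

theorem card_blockFirst : ((runArray T n (blockFirst T n)).toFinset).card = numRuns T n := by
  rw [toFinset_runArray, Finset.card_image_of_injOn blockFirst_injOn]
  simp

/-- The block starts up to `x` are those of the blocks `1, …, i`, and they are distinct; so the rank
is directly the index of the block. -/
theorem pred_blockFirst {i x : ℕ} (hi : i ∈ Finset.Icc 1 (numRuns T n))
    (h : blockFirst T n i ≤ x ∧ x ≤ blockLast T n i) :
    pred (runArray T n (blockFirst T n)).toFinset x = i := by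
  have hi' := Finset.mem_Icc.1 hi
  have : (runArray T n (blockFirst T n)).toFinset.filter (fun y => y ≤ x) =
      (Finset.Icc 1 i).image (blockFirst T n) := by
    ext y
    rw [toFinset_runArray, Finset.mem_filter, Finset.mem_image, Finset.mem_image]
    constructor
    · rintro ⟨⟨i', hm, rfl⟩, hle⟩
      have := block_le hm hi le_rfl h.2 hle
      exact ⟨i', Finset.mem_Icc.2 ⟨(Finset.mem_Icc.1 hm).1, this⟩, rfl⟩
    · rintro ⟨i', hm, rfl⟩
      rw [Finset.mem_Icc] at hm
      refine ⟨⟨i', Finset.mem_Icc.2 (by omega), rfl⟩, ?_⟩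
      rcases hm.2.eq_or_lt with rfl | hlt
      · exact h.1
      · exact (runOrder_lt hm.1 hlt hi'.2).2.trans h.1
  rw [pred, this, Finset.card_image_of_injOn]
  · simp
  · refine blockFirst_injOn.mono ?_
    simp only [Finset.coe_Icc]
    exact Set.Icc_subset_Icc_right hi'.2

/-! ### Table entries, open and close positions -/

theorem length_runArray {β : Type} (f : ℕ → β) : (runArray T n f).length = numRuns T n := by
  simp [runArray]

theorem runArray_getElem? {β : Type} (f : ℕ → β) {i : ℕ}
    (hi : i ∈ Finset.Icc 1 (numRuns T n)) : (runArray T n f)[i - 1]? = some (f i) := by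
  rw [Finset.mem_Icc] at hi
  rw [runArray, List.getElem?_map, List.getElem?_range' (by omega)]
  simp [Nat.add_sub_cancel' hi.1]

theorem mem_largePositions {k i j : ℕ} :
    j ∈ largePositions T n k i ↔
      (blockFirst T n i ≤ j ∧ j ≤ blockLast T n i) ∧ k < suffixArray T n j := by
  simp [largePositions]

theorem openPos_le {k i j : ℕ} (hj : j ∈ largePositions T n k i) : openPos T n k i ≤ j :=
  Finset.min'_le _ _ (Finset.mem_insert_of_mem hj)

theorem le_closePos {k i j : ℕ} (hj : j ∈ largePositions T n k i) : j ≤ closePos T n k i :=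
  Finset.le_max' _ _ (Finset.mem_insert_of_mem hj)

theorem openPos_eq_or_mem (k i : ℕ) :
    openPos T n k i = n + 1 ∨ openPos T n k i ∈ largePositions T n k i :=
  Finset.mem_insert.1 (Finset.min'_mem _ _)

theorem closePos_eq_or_mem (k i : ℕ) :
    closePos T n k i = 0 ∨ closePos T n k i ∈ largePositions T n k i :=
  Finset.mem_insert.1 (Finset.max'_mem _ _)

theorem openPos_le_succ (k i : ℕ) : openPos T n k i ≤ n + 1 :=
  Finset.min'_le _ _ (Finset.mem_insert_self _ _)

theorem closePos_le {k i : ℕ} (hi : i ∈ Finset.Icc 1 (numRuns T n)) : closePos T n k i ≤ n := by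
  rcases closePos_eq_or_mem (T := T) (n := n) k i with h | h
  · omega
  · exact (Finset.mem_Icc.1 (mem_of_mem_block hi (mem_largePositions.1 h).1)).2

/-- The default `n + 1` cannot pass the test against `e ≤ n`; dually, the default `0` of a close
position fails against `1 ≤ b`. The query thus needs no test for defaults. -/
theorem isRMTQAnswer_openVal {b e k i : ℕ} (he : e ≤ n) (hb : b ≤ openPos T n k i)
    (hle : openPos T n k i ≤ e) : IsRMTQAnswer (suffixArray T n) b e k (openVal T n k i) := by
  refine Or.inl ⟨openPos T n k i, Finset.mem_Icc.2 ⟨hb, hle⟩, ?_, ?_⟩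
  · rcases openPos_eq_or_mem (T := T) (n := n) k i with h | h
    · omega
    · exact (mem_largePositions.1 h).2
  · rw [openVal, if_pos (by omega)]

theorem isRMTQAnswer_closeVal {b e k i : ℕ} (h1 : 1 ≤ b) (hb : b ≤ closePos T n k i)
    (hle : closePos T n k i ≤ e) : IsRMTQAnswer (suffixArray T n) b e k (closeVal T n k i) := by
  refine Or.inl ⟨closePos T n k i, Finset.mem_Icc.2 ⟨hb, hle⟩, ?_, ?_⟩
  · rcases closePos_eq_or_mem (T := T) (n := n) k i with h | h
    · omega
    · exact (mem_largePositions.1 h).2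
  · rw [closeVal, if_pos (by omega)]

theorem blockMax_le {i : ℕ} (hi : i ∈ Finset.Icc 1 (numRuns T n)) : blockMax T n i ≤ n := by
  unfold blockMax rmq
  refine Finset.sup_le fun j hj => ?_
  exact (Finset.mem_Icc.1 (suffixArray_mem (mem_of_mem_block hi (Finset.mem_Icc.1 hj)))).2

/-- In case (B), a value larger than `k` in `[b, e]` is found at the `k`-close position of the
first block, at the `k`-open position of the last block, or in a block in between. -/
theorem exists_between_of_large {b e k ib ie j : ℕ} (hB : CaseB T n b e)
    (h1 : 1 ≤ b) (he : e ≤ n)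
    (hib : ib ∈ Finset.Icc 1 (numRuns T n)) (hie : ie ∈ Finset.Icc 1 (numRuns T n))
    (hb : blockFirst T n ib ≤ b ∧ b ≤ blockLast T n ib)
    (he' : blockFirst T n ie ≤ e ∧ e ≤ blockLast T n ie)
    (hj : j ∈ Finset.Icc b e) (hk : k < suffixArray T n j) :
    (b ≤ closePos T n k ib ∧ closePos T n k ib ≤ e) ∨
      (b ≤ openPos T n k ie ∧ openPos T n k ie ≤ e) ∨
      ∃ i, ib < i ∧ i < ie ∧ k < blockMax T n i := by
  rw [Finset.mem_Icc] at hj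
  obtain ⟨i, hi, hji⟩ := exists_block (T := T) (Finset.mem_Icc.2 ⟨h1.trans hj.1, hj.2.trans he⟩)
  have hbi := block_le hib hi hb.1 hji.2 hj.1
  have hie' := block_le hi hie hji.1 he'.2 hj.2
  have hlarge : j ∈ largePositions T n k i := mem_largePositions.2 ⟨hji, hk⟩
  have hclose : ∀ {i}, j ∈ largePositions T n k i → closePos T n k i ≤ blockLast T n i := by
    intro i h
    have h2 := le_closePos h
    rcases closePos_eq_or_mem (T := T) (n := n) k i with h' | h'
    · omega
    · exact (mem_largePositions.1 h').1.2
  -- The witness `j ≤ n` rules out the default `n + 1`, so the open position lies in the block.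
  have hopen : ∀ {i}, j ∈ largePositions T n k i → blockFirst T n i ≤ openPos T n k i := by
    intro i h
    have h2 := openPos_le h
    rcases openPos_eq_or_mem (T := T) (n := n) k i with h' | h'
    · omega
    · exact (mem_largePositions.1 h').1.1
  rcases hbi.eq_or_lt with rfl | hbi
  · have h2 := le_closePos hlarge
    have h3 := hclose hlarge
    rcases hie'.eq_or_lt with rfl | hie'
    · have h4 := openPos_le hlarge
      have h5 := hopen hlarge
      -- The only use of case (B): with both ends in one block, either `e` reaches the block's end
      -- and the close position serves, or `b` is its start and the open position serves.
      by_cases hfirst : blockFirst T n ib < b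
      · have : ¬ e < blockLast T n ib := fun h => hB ⟨ib, hib, hfirst, h⟩
        exact Or.inl ⟨by omega, by omega⟩
      · exact Or.inr (Or.inl ⟨by omega, by omega⟩)
    · have := blockLast_lt_blockFirst hib hie hie'
      exact Or.inl ⟨by omega, by omega⟩
  · rcases hie'.eq_or_lt with rfl | hie'
    · have h4 := openPos_le hlarge
      have h5 := hopen hlarge
      have := blockLast_lt_blockFirst hib hi hbi
      exact Or.inr (Or.inl ⟨by omega, by omega⟩)
    · refine Or.inr (Or.inr ⟨i, hbi, hie', hk.trans_le ?_⟩)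
      exact Finset.le_sup (f := suffixArray T n) (Finset.mem_Icc.2 hji)

/-- The maximum is attained at a position of a middle block, and such a block lies entirely between
`b` and `e`. -/
theorem isRMTQAnswer_rmq {b e k ib ie : ℕ}
    (hib : ib ∈ Finset.Icc 1 (numRuns T n)) (hie : ie ∈ Finset.Icc 1 (numRuns T n))
    (hb : b ≤ blockLast T n ib) (he : blockFirst T n ie ≤ e) (hlt : ib + 1 < ie)
    (hk : k < rmq (blockMax T n) (ib + 1) (ie - 1)) :
    IsRMTQAnswer (suffixArray T n) b e k (rmq (blockMax T n) (ib + 1) (ie - 1) : ℕ) := by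
  obtain ⟨i, hi, hmax⟩ := Finset.exists_mem_eq_sup (Finset.Icc (ib + 1) (ie - 1))
    ⟨ib + 1, Finset.mem_Icc.2 (by omega)⟩ (blockMax T n)
  rw [Finset.mem_Icc] at hi
  have hir : i ∈ Finset.Icc 1 (numRuns T n) := by
    rw [Finset.mem_Icc] at hib hie ⊢
    omega
  obtain ⟨j, hj, hmax'⟩ := Finset.exists_mem_eq_sup
    (Finset.Icc (blockFirst T n i) (blockLast T n i))
    ⟨_, Finset.mem_Icc.2 ⟨le_rfl, blockFirst_le_blockLast hir⟩⟩ (suffixArray T n)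
  have heq : rmq (blockMax T n) (ib + 1) (ie - 1) = suffixArray T n j := hmax.trans hmax'
  rw [Finset.mem_Icc] at hj
  have h₁ := blockLast_lt_blockFirst hib hir (by omega)
  have h₂ := blockLast_lt_blockFirst hir hie (by omega)
  exact Or.inl ⟨j, Finset.mem_Icc.2 ⟨by omega, by omega⟩, heq ▸ hk, by rw [heq]⟩

theorem rmq_runArray {i j : ℕ} (f : ℕ → ℕ) (hi : 1 ≤ i) (hj : j ≤ numRuns T n) :
    rmq (fun l => (runArray T n f).getD (l - 1) 0) i j = rmq f i j := by
  unfold rmq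
  refine Finset.sup_congr rfl fun l hl => ?_
  rw [Finset.mem_Icc] at hl
  rw [List.getD_eq_getElem?_getD, runArray_getElem? f (Finset.mem_Icc.2 (by omega))]
  rfl

end Text

/-! ### The query program of case (B) -/

theorem DataStructure.HasSpace.mono {I : Type*} {D : DataStructure I} {w : ℕ} {x : I}
    {a b : ℕ} (h : D.HasSpace w x a) (hab : a ≤ b) : D.HasSpace w x b :=
  ⟨h.1, fun m hm => (h.2 m hm).trans hab⟩

theorem DataStructure.Answers.mono {I : Type*} {D : DataStructure I} {w : ℕ} {x : I}
    {args : List ℕ} {a b : ℕ} {spec : ℤ → Prop} (h : D.Answers w x args a spec) (hab : a ≤ b) :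
    D.Answers w x args b spec := by
  intro s hs ha
  obtain ⟨t, s', ht, h⟩ := h s hs ha
  exact ⟨t, s', ht.trans hab, h⟩

theorem IsRMQStructure.mono {A a b : ℕ} {D : DataStructure (List ℕ)} (h : IsRMQStructure A a D)
    (hab : a ≤ b) : IsRMQStructure A b D := by
  intro w u l hl hlen hval hw
  obtain ⟨h₁, h₂⟩ := h w u l hl hlen hval hw
  exact ⟨h₁.mono (Nat.mul_le_mul_right _ hab), fun i j hi hij hj => (h₂ i j hi hij hj).mono hab⟩

namespace CaseBQuery

/-- The first 16 registers are reserved for the calling program. -/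
def shift (r : ℕ) : ℕ := r + 16

theorem shift_injective : Function.Injective shift := fun _ _ h => Nat.add_right_cancel h

theorem not_mem_range_shift {r : ℕ} (hr : r < 16) : r ∉ Set.range shift := by
  rintro ⟨x, rfl⟩
  simp only [shift] at hr
  omega

variable (P : DataStructure (ℕ × Finset ℕ)) (R : DataStructure (List ℕ))

/-- The arrays of the structure. -/
abbrev Arrays : Type := CaseBArr ⊕ P.Arr ⊕ R.Arr

/-- The predecessor query as a subroutine. -/
def predCall : Cmd (Arrays P R) := P.query.rename shift fun a => .inr (.inl a)

/-- The range maximum query as a subroutine. -/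
def rmqCall : Cmd (Arrays P R) := R.query.rename shift fun a => .inr (.inr a)

/-- Answering `-1`. -/
def none : Cmd (Arrays P R) := .seq (.const 0 0) <| .seq (.const 5 1) <| .op .sub 0 0 5

/-- Searching the blocks strictly between the first and the last one. -/
def middle : Cmd (Arrays P R) :=
  .seq (.op .add 8 3 5) <|
  .ifLt 9 8 4
    (.seq (.mov 16 8) <| .seq (.mov 17 7) <| .seq (rmqCall P R) <|
      .ifLt 9 2 16 (.mov 0 16) (none P R))
    (none P R)

/-- Trying the `k`-open position of the last block. -/
def tryOpen : Cmd (Arrays P R) :=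
  .seq (.load 8 (.inl .openPos) 7) <|
  .ifLt 9 8 0 (middle P R) <| .ifLt 9 1 8 (middle P R) <| .load 0 (.inl .openVal) 7

/-- Trying the `k`-close position of the first block. -/
def tryClose : Cmd (Arrays P R) :=
  .seq (.load 8 (.inl .closePos) 6) <|
  .ifLt 9 8 0 (tryOpen P R) <| .ifLt 9 1 8 (tryOpen P R) <| .load 0 (.inl .closeVal) 6

/-- The query program: it locates the blocks of the end points and searches. -/
def prog : Cmd (Arrays P R) :=
  .seq (.mov 16 0) <| .seq (predCall P R) <| .seq (.mov 3 16) <|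
  .seq (.mov 16 1) <| .seq (predCall P R) <| .seq (.mov 4 16) <|
  .seq (.const 5 1) <| .seq (.op .sub 6 3 5) <| .seq (.op .sub 7 4 5) <| tryClose P R

variable {P R}

/-- The registers after the blocks `ib` and `ie` of the end points have been located. -/
def Located {w : ℕ} (s : RamState w (Arrays P R)) (b e k ib ie : ℕ) : Prop :=
  s.reg 0 = BitVec.ofNat w b ∧ s.reg 1 = BitVec.ofNat w e ∧ s.reg 2 = BitVec.ofNat w k ∧
    s.reg 3 = BitVec.ofNat w ib ∧ s.reg 4 = BitVec.ofNat w ie ∧ s.reg 5 = BitVec.ofNat w 1 ∧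
    s.reg 6 = BitVec.ofNat w (ib - 1) ∧ s.reg 7 = BitVec.ofNat w (ie - 1)

/-- Registers from `8` on are scratch space, so the located data survives all tests and loads. -/
theorem Located.setReg {w : ℕ} {s : RamState w (Arrays P R)} {b e k ib ie r : ℕ}
    (h : Located s b e k ib ie) (hr : 8 ≤ r) (v : BitVec w) :
    Located (s.setReg r v) b e k ib ie := by
  have : ∀ i < 8, (s.setReg r v).reg i = s.reg i := fun i hi => by
    rw [RamState.setReg_reg, if_neg (by omega)]
  unfold Located
  rw [this 0 (by norm_num), this 1 (by norm_num), this 2 (by norm_num), this 3 (by norm_num),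
    this 4 (by norm_num), this 5 (by norm_num), this 6 (by norm_num), this 7 (by norm_num)]
  exact h

variable {α : Type*} [LinearOrder α] {T : ℕ → α} {n k w : ℕ}

/-- The postcondition of a query. -/
def Answered (T : ℕ → α) (n k w b e : ℕ) (s : RamState w (Arrays P R)) : Prop :=
  (caseBStructure α P R (prog P R)).Valid w (T, n, k) s.mem ∧
    ∃ v : ℤ, IsRMTQAnswer (suffixArray T n) b e k v ∧ s.reg 0 = BitVec.ofInt w v

/-- Computing `0 - 1` wraps around to the two's complement word of `-1`. -/
theorem none_halts {s : RamState w (Arrays P R)} {b e : ℕ}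
    (hs : (caseBStructure α P R (prog P R)).Valid w (T, n, k) s.mem)
    (h : ∀ j ∈ Finset.Icc b e, suffixArray T n j ≤ k) :
    (none P R).Halts s 3 (Answered T n k w b e) := by
  refine .seq_const <| .seq_const <| .op (v := BitVec.ofInt w (-1)) ?_
    ⟨hs, -1, Or.inr ⟨h, rfl⟩, by simp⟩
  simp [WordOp.apply, BitVec.ofInt_neg]

/-- `hrest` records that the two end blocks have been ruled out: any remaining large value forces a
large maximum in a middle block, so a range maximum of at most `k` justifies `-1`. -/
theorem middle_halts {A u : ℕ} (hA : 1 ≤ A) (hR : IsRMQStructure A u R) (hw : WordSizeOK A n w)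
    {s : RamState w (Arrays P R)} {b e ib ie : ℕ} (hk : k ≤ n)
    (hs : (caseBStructure α P R (prog P R)).Valid w (T, n, k) s.mem)
    (hl : Located s b e k ib ie)
    (hib : ib ∈ Finset.Icc 1 (numRuns T n)) (hie : ie ∈ Finset.Icc 1 (numRuns T n))
    (hb : b ≤ blockLast T n ib) (he : blockFirst T n ie ≤ e)
    (hrest : ∀ j ∈ Finset.Icc b e, k < suffixArray T n j →
      ∃ i, ib < i ∧ i < ie ∧ k < blockMax T n i) :
    (middle P R).Halts s (u + 20) (Answered T n k w b e) := by
  have hib' := Finset.mem_Icc.1 hib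
  have hie' := Finset.mem_Icc.1 hie
  have hrn := numRuns_le (T := T) (n := n)
  have hlt : ∀ {x}, x ≤ n + 1 → x < 2 ^ w := fun hx => hw.lt_two_pow hA hx
  have hw0 : 0 < w := hw.pos hA
  have hl' := hl
  obtain ⟨h0, h1, h2, h3, h4, h5, h6, h7⟩ := hl'
  refine .seq_add h3 h5 <| .ifLt (x := ib + 1) (y := ie) hw0 (by simp) (by simp [h4])
    (hlt (by omega)) (hlt (by omega)) (fun hlt' => ?_) fun hge => ?_
  · refine .seq_mov (v := BitVec.ofNat w (ib + 1)) (by simp) <|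
      .seq_mov (v := BitVec.ofNat w (ie - 1)) (by simp [h7]) ?_
    obtain ⟨v1, v2, v3, v4, v5, v6, vP, vR⟩ := hs
    have hans := (hR w n (runArray T n (blockMax T n))
      (by rw [ne_eq, ← List.length_eq_zero_iff, length_runArray]; omega)
      (by rw [length_runArray]; exact hrn)
      (by
        intro y hy
        obtain ⟨i, hi, rfl⟩ := List.mem_map.1 hy
        rw [List.mem_range'_1] at hi
        exact blockMax_le (Finset.mem_Icc.2 (by omega))) hw).2 (ib + 1) (ie - 1) (by omega)
      (by omega) (by rw [length_runArray]; omega)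
    rw [rmq_runArray _ (by omega) (by omega)] at hans
    refine Cmd.Halts.mono (T₁ := 10 + u) ?_ (by omega)
    refine Cmd.Halts.seq (hans.call (κ := Arrays P R) shift_injective
      (g := fun a => .inr (.inr a)) (fun _ _ h => Sum.inr_injective (Sum.inr_injective h)) _ vR
      ?_) ?_
    · intro i hi
      simp only [List.length_cons, List.length_nil] at hi
      interval_cases i <;> simp [shift]
    · rintro s' ⟨vR', ⟨v, rfl, hv⟩, ho⟩
      rw [BitVec.ofInt_natCast] at hv
      have hs' : (caseBStructure α P R (prog P R)).Valid w (T, n, k) s'.mem := by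
        have hm₁ : ∀ a, s'.mem (.inl a) = s.mem (.inl a) := fun a => ho.2 _ (by simp)
        have hm₂ : ∀ a, s'.mem (.inr (.inl a)) = s.mem (.inr (.inl a)) := fun a =>
          ho.2 _ (by simp)
        refine ⟨?_, ?_, ?_, ?_, ?_, ?_, ?_, vR'⟩
        · rw [hm₁]; exact v1
        · rw [hm₁]; exact v2
        · rw [hm₁]; exact v3
        · rw [hm₁]; exact v4
        · rw [hm₁]; exact v5
        · rw [hm₁]; exact v6
        · simp only [hm₂]; exact vP
      have h2' : s'.reg 2 = BitVec.ofNat w k := by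
        rw [ho.1 2 (not_mem_range_shift (by norm_num))]
        simp [h2]
      have hmax : rmq (blockMax T n) (ib + 1) (ie - 1) ≤ n := by
        refine Finset.sup_le fun i hi => blockMax_le ?_
        rw [Finset.mem_Icc] at hi ⊢
        omega
      refine .ifLt hw0 h2' hv (hlt (by omega)) (hlt (by omega)) (fun hkr => ?_) fun hkr => ?_
      · exact .mov (v := BitVec.ofNat w (rmq (blockMax T n) (ib + 1) (ie - 1)))
          (by simpa [shift] using hv)
          ⟨hs', _, isRMTQAnswer_rmq hib hie hb he hlt' hkr, by simp⟩
      · refine (none_halts (s := s'.setReg 9 _) hs' fun j hj => ?_).mono (by norm_num)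
        by_contra hcon
        obtain ⟨i, hi, hi', hki⟩ := hrest j hj (not_le.1 hcon)
        have : blockMax T n i ≤ rmq (blockMax T n) (ib + 1) (ie - 1) :=
          Finset.le_sup (f := blockMax T n) (Finset.mem_Icc.2 (by omega))
        omega
  · refine (none_halts (s := (s.setReg 8 _).setReg 9 _) hs fun j hj => ?_).mono (by omega)
    by_contra hcon
    obtain ⟨i, hi, hi', -⟩ := hrest j hj (not_le.1 hcon)
    omega

theorem tryOpen_halts {A u : ℕ} (hA : 1 ≤ A) (hR : IsRMQStructure A u R) (hw : WordSizeOK A n w)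
    {s : RamState w (Arrays P R)} {b e ib ie : ℕ} (hk : k ≤ n) (hbe : b ≤ e) (hen : e ≤ n)
    (hs : (caseBStructure α P R (prog P R)).Valid w (T, n, k) s.mem)
    (hl : Located s b e k ib ie)
    (hib : ib ∈ Finset.Icc 1 (numRuns T n)) (hie : ie ∈ Finset.Icc 1 (numRuns T n))
    (hb : b ≤ blockLast T n ib) (he : blockFirst T n ie ≤ e)
    (hrest : ∀ j ∈ Finset.Icc b e, k < suffixArray T n j →
      (b ≤ openPos T n k ie ∧ openPos T n k ie ≤ e) ∨
        ∃ i, ib < i ∧ i < ie ∧ k < blockMax T n i) :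
    (tryOpen P R).Halts s (u + 25) (Answered T n k w b e) := by
  have hie' := Finset.mem_Icc.1 hie
  have hrn := numRuns_le (T := T) (n := n)
  have hlt : ∀ {x}, x ≤ n + 1 → x < 2 ^ w := fun hx => hw.lt_two_pow hA hx
  have hw0 : 0 < w := hw.pos hA
  obtain ⟨h0, h1, h2, h3, h4, h5, h6, h7⟩ := hl
  have hl : Located s b e k ib ie := ⟨h0, h1, h2, h3, h4, h5, h6, h7⟩
  have hs' := hs
  obtain ⟨-, -, v3, v4, -, -, -, -⟩ := hs'
  have hop := openPos_le_succ (T := T) (n := n) k ie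
  refine .seq_load v3 h7 (hlt (by omega)) (runArray_getElem? _ hie) <|
    .ifLt (x := openPos T n k ie) (y := b) hw0 (by simp) (by simp [h0]) (hlt (by omega))
      (hlt (by omega)) (fun hlt' => ?_) fun hge =>
    .ifLt (x := e) (y := openPos T n k ie) hw0 (by simp [h1]) (by simp) (hlt (by omega))
      (hlt (by omega)) (fun hlt' => ?_) fun hge' => ?_
  · refine (middle_halts (s := (s.setReg 8 _).setReg 9 _) hA hR hw hk hs
      ((hl.setReg (by norm_num) _).setReg (by norm_num) _) hib hie hb he fun j hj hkj => ?_).mono (by omega)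
    exact (hrest j hj hkj).resolve_left (by omega)
  · refine (middle_halts (s := ((s.setReg 8 _).setReg 9 _).setReg 9 _) hA hR hw hk hs
      (((hl.setReg (by norm_num) _).setReg (by norm_num) _).setReg (by norm_num) _)
      hib hie hb he fun j hj hkj => ?_).mono (by omega)
    exact (hrest j hj hkj).resolve_left (by omega)
  · exact .load v4 (by simp [h7]) (hlt (by omega)) (runArray_getElem? _ hie)
      ⟨hs, _, isRMTQAnswer_openVal hen hge hge', by simp⟩

theorem tryClose_halts {A u : ℕ} (hA : 1 ≤ A) (hR : IsRMQStructure A u R)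
    (hw : WordSizeOK A n w) {s : RamState w (Arrays P R)} {b e ib ie : ℕ} (hk : k ≤ n)
    (hb1 : 1 ≤ b) (hbe : b ≤ e) (hen : e ≤ n) (hB : CaseB T n b e)
    (hs : (caseBStructure α P R (prog P R)).Valid w (T, n, k) s.mem)
    (hl : Located s b e k ib ie)
    (hib : ib ∈ Finset.Icc 1 (numRuns T n)) (hie : ie ∈ Finset.Icc 1 (numRuns T n))
    (hb : blockFirst T n ib ≤ b ∧ b ≤ blockLast T n ib)
    (he : blockFirst T n ie ≤ e ∧ e ≤ blockLast T n ie) :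
    (tryClose P R).Halts s (u + 30) (Answered T n k w b e) := by
  have hib' := Finset.mem_Icc.1 hib
  have hrn := numRuns_le (T := T) (n := n)
  have hlt : ∀ {x}, x ≤ n + 1 → x < 2 ^ w := fun hx => hw.lt_two_pow hA hx
  have hw0 : 0 < w := hw.pos hA
  obtain ⟨h0, h1, h2, h3, h4, h5, h6, h7⟩ := hl
  have hl : Located s b e k ib ie := ⟨h0, h1, h2, h3, h4, h5, h6, h7⟩
  have hs' := hs
  obtain ⟨-, -, -, -, v5, v6, -, -⟩ := hs'
  have hcl := closePos_le (T := T) (n := n) (k := k) hib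
  refine .seq_load v5 h6 (hlt (by omega)) (runArray_getElem? _ hib) <|
    .ifLt (x := closePos T n k ib) (y := b) hw0 (by simp) (by simp [h0]) (hlt (by omega))
      (hlt (by omega)) (fun hlt' => ?_) fun hge =>
    .ifLt (x := e) (y := closePos T n k ib) hw0 (by simp [h1]) (by simp) (hlt (by omega))
      (hlt (by omega)) (fun hlt' => ?_) fun hge' => ?_
  · refine (tryOpen_halts (s := (s.setReg 8 _).setReg 9 _) hA hR hw hk hbe hen hs
      ((hl.setReg (by norm_num) _).setReg (by norm_num) _)
      hib hie hb.2 he.1 fun j hj hkj => ?_).mono (by omega)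
    exact (exists_between_of_large hB hb1 hen hib hie hb he hj hkj).resolve_left (by omega)
  · refine (tryOpen_halts (s := ((s.setReg 8 _).setReg 9 _).setReg 9 _) hA hR hw hk hbe hen hs
      (((hl.setReg (by norm_num) _).setReg (by norm_num) _).setReg (by norm_num) _)
      hib hie hb.2 he.1 fun j hj hkj => ?_).mono (by omega)
    exact (exists_between_of_large hB hb1 hen hib hie hb he hj hkj).resolve_left (by omega)
  · exact .load v6 (by simp [h6]) (hlt (by omega)) (runArray_getElem? _ hib)
      ⟨hs, _, isRMTQAnswer_closeVal hb1 hge hge', by simp⟩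

/-- The subroutine works on its own arrays and on registers from `16` on, so the other tables and
the caller's registers are unchanged. -/
theorem predCall_halts {A c : ℕ} {Q : ℕ → ℕ → ℕ} (hP : IsPredecessorStructure A c Q P)
    (hw : WordSizeOK A n w) (hn : 1 ≤ n) {s : RamState w (Arrays P R)} {x i : ℕ}
    (hx : x ∈ Finset.Icc 1 n)
    (hs : (caseBStructure α P R (prog P R)).Valid w (T, n, k) s.mem)
    (hreg : s.reg 16 = BitVec.ofNat w x) (hi : i ∈ Finset.Icc 1 (numRuns T n))
    (hxi : blockFirst T n i ≤ x ∧ x ≤ blockLast T n i) :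
    (predCall P R).Halts s (Q (numRuns T n) n) fun s' =>
      (caseBStructure α P R (prog P R)).Valid w (T, n, k) s'.mem ∧
        s'.reg 16 = BitVec.ofNat w i ∧ ∀ r < 16, s'.reg r = s.reg r := by
  obtain ⟨v1, v2, v3, v4, v5, v6, vP, vR⟩ := hs
  have hsub : (runArray T n (blockFirst T n)).toFinset ⊆ Finset.Icc 1 n := by
    rw [toFinset_runArray, Finset.image_subset_iff]
    exact fun i hi => blockFirst_mem hi
  have hne : (runArray T n (blockFirst T n)).toFinset.Nonempty := by
    rw [← Finset.card_pos, card_blockFirst]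
    exact numRuns_pos hn
  have hans := (hP w n _ hne hsub hw).2 x hx
  rw [card_blockFirst, pred_blockFirst hi hxi] at hans
  obtain ⟨t, s', ht, hr, vP', ⟨v, rfl, hv⟩, ho⟩ := hans.call (κ := Arrays P R) shift_injective
    (g := fun a => .inr (.inl a)) (fun _ _ h => Sum.inl_injective (Sum.inr_injective h)) s vP
    (by
      intro i hi
      obtain rfl : i = 0 := by simpa using hi
      simpa [shift] using hreg)
  rw [BitVec.ofInt_natCast] at hv
  have hm₁ : ∀ a, s'.mem (.inl a) = s.mem (.inl a) := fun a => ho.2 _ (by simp)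
  have hm₂ : ∀ a, s'.mem (.inr (.inr a)) = s.mem (.inr (.inr a)) := fun a => ho.2 _ (by simp)
  refine ⟨t, s', ht, hr, ⟨?_, ?_, ?_, ?_, ?_, ?_, vP', ?_⟩, hv, fun r hr =>
    ho.1 r (not_mem_range_shift hr)⟩
  · rw [hm₁]; exact v1
  · rw [hm₁]; exact v2
  · rw [hm₁]; exact v3
  · rw [hm₁]; exact v4
  · rw [hm₁]; exact v5
  · rw [hm₁]; exact v6
  · simp only [hm₂]; exact vR

theorem answers {A c u : ℕ} (hA : 1 ≤ A) {Q : ℕ → ℕ → ℕ} (hP : IsPredecessorStructure A c Q P)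
    (hR : IsRMQStructure A u R) (hw : WordSizeOK A n w) {b e : ℕ} (hk : k ≤ n)
    (hb1 : 1 ≤ b) (hbe : b ≤ e) (hen : e ≤ n) (hB : CaseB T n b e) :
    (caseBStructure α P R (prog P R)).Answers w (T, n, k) [b, e, k]
      (2 * Q (numRuns T n) n + u + 40) (IsRMTQAnswer (suffixArray T n) b e k) := by
  intro (s : RamState w (Arrays P R)) hs hargs
  have h0 : s.reg 0 = BitVec.ofNat w b := hargs 0 (by simp)
  have h1 : s.reg 1 = BitVec.ofNat w e := hargs 1 (by simp)
  have h2 : s.reg 2 = BitVec.ofNat w k := hargs 2 (by simp)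
  have hbm : b ∈ Finset.Icc 1 n := Finset.mem_Icc.2 (by omega)
  have hem : e ∈ Finset.Icc 1 n := Finset.mem_Icc.2 (by omega)
  obtain ⟨ib, hib, hb⟩ := exists_block (T := T) hbm
  obtain ⟨ie, hie, he⟩ := exists_block (T := T) hem
  have hib' := Finset.mem_Icc.1 hib
  have hie' := Finset.mem_Icc.1 hie
  set q := Q (numRuns T n) n with hq
  -- Two predecessor calls of cost `q`, the search of cost `u + 30`, and seven register
  -- instructions, grouped as `Cmd.Halts.seq` produces them.
  have key : (prog P R).Halts s ((u + 30 + 4 + q + 2) + q + 1) (Answered T n k w b e) := by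
    refine .seq_mov h0 <| .seq (T₂ := u + 30 + 4 + q + 2)
      (predCall_halts hP hw (by omega) hbm hs (by simp) hib hb) ?_
    rintro s₁ ⟨hs₁, hr₁, ho₁⟩
    have h0₁ : s₁.reg 0 = BitVec.ofNat w b := by rw [ho₁ 0 (by norm_num)]; simp [h0]
    have h1₁ : s₁.reg 1 = BitVec.ofNat w e := by rw [ho₁ 1 (by norm_num)]; simp [h1]
    have h2₁ : s₁.reg 2 = BitVec.ofNat w k := by rw [ho₁ 2 (by norm_num)]; simp [h2]
    refine .seq_mov hr₁ <| .seq_mov (v := BitVec.ofNat w e) (by simp [h1₁]) <|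
      .seq (T₂ := u + 30 + 4)
      (predCall_halts hP hw (by omega) hem hs₁ (by simp) hie he) ?_
    rintro s₂ ⟨hs₂, hr₂, ho₂⟩
    refine .seq_mov hr₂ <| .seq_const <|
      .seq_sub (x := ib) (y := 1) ?_ (by simp) hib'.1 <|
      .seq_sub (x := ie) (y := 1) (by simp) (by simp) hie'.1 <|
      tryClose_halts hA hR hw hk hb1 hbe hen hB hs₂ ?_ hib hie hb he
    · simp [ho₂ 3]
    · simp [Located, ho₂, h0₁, h1₁, h2₁]
  obtain ⟨t, s', ht, hr, hv, hres⟩ := key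
  exact ⟨t, s', by omega, hr, hv, hres⟩

/-- There are `r` distinct block starts and `r` block maxima, so the linear bounds of both
substructures are linear in `r`; the remaining six arrays have length `r`. -/
theorem hasSpace {A c u : ℕ} {Q : ℕ → ℕ → ℕ} (hP : IsPredecessorStructure A c Q P)
    (hR : IsRMQStructure A u R) (hw : WordSizeOK A n w) (hn : 1 ≤ n) :
    (caseBStructure α P R (prog P R)).HasSpace w (T, n, k) ((6 + c + u) * numRuns T n) := by
  have hr := numRuns_pos (T := T) hn
  have hsub : (runArray T n (blockFirst T n)).toFinset ⊆ Finset.Icc 1 n := by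
    rw [toFinset_runArray, Finset.image_subset_iff]
    exact fun i hi => blockFirst_mem hi
  have hne : (runArray T n (blockFirst T n)).toFinset.Nonempty := by
    rw [← Finset.card_pos, card_blockFirst]
    exact hr
  obtain ⟨⟨mP, hmP⟩, hPs⟩ := (hP w n _ hne hsub hw).1
  obtain ⟨⟨mR, hmR⟩, hRs⟩ := (hR w n (runArray T n (blockMax T n))
    (by rw [ne_eq, ← List.length_eq_zero_iff, length_runArray]; omega)
    (by rw [length_runArray]; exact numRuns_le)
    (by
      intro y hy
      obtain ⟨i, hi, rfl⟩ := List.mem_map.1 hy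
      rw [List.mem_range'_1] at hi
      exact blockMax_le (Finset.mem_Icc.2 (by omega))) hw).1
  refine ⟨⟨Sum.elim (fun
    | .start => runArray T n (fun i => BitVec.ofNat w (blockFirst T n i))
    | .max => runArray T n (fun i => BitVec.ofNat w (blockMax T n i))
    | .openPos => runArray T n (fun i => BitVec.ofNat w (openPos T n k i))
    | .openVal => runArray T n (fun i => BitVec.ofInt w (openVal T n k i))
    | .closePos => runArray T n (fun i => BitVec.ofNat w (closePos T n k i))
    | .closeVal => runArray T n (fun i => BitVec.ofInt w (closeVal T n k i)))
    (Sum.elim mP mR), rfl, rfl, rfl, rfl, rfl, rfl, hmP, hmR⟩, ?_⟩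
  rintro m ⟨v1, v2, v3, v4, v5, v6, vP, vR⟩
  have hp := hPs _ vP
  have hq := hRs _ vR
  rw [card_blockFirst] at hp
  rw [length_runArray] at hq
  let _ := P.fin
  let _ := R.fin
  have h6 : ∑ a : CaseBArr, (m (.inl a)).length ≤ 6 * numRuns T n := by
    have : ∀ a : CaseBArr, (m (.inl a)).length = numRuns T n := by
      intro a
      cases a
      · rw [v1, length_runArray]
      · rw [v2, length_runArray]
      · rw [v3, length_runArray]
      · rw [v4, length_runArray]
      · rw [v5, length_runArray]
      · rw [v6, length_runArray]
    rw [Finset.sum_congr rfl fun a _ => this a, Finset.sum_const, smul_eq_mul]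
    exact Nat.mul_le_mul_right _ (by decide)
  change ∑ a : CaseBArr ⊕ P.Arr ⊕ R.Arr, (m a).length ≤ _
  rw [Fintype.sum_sum_type, Fintype.sum_sum_type, add_mul, add_mul]
  exact (Nat.add_le_add h6 (Nat.add_le_add hp hq)).trans (by omega)

end CaseBQuery

theorem mainTheorem4 (A c : ℕ) (hA : 1 ≤ A) (Q : ℕ → ℕ → ℕ)
    (P : DataStructure (ℕ × Finset ℕ)) (hP : IsPredecessorStructure A c Q P) :
    ∃ (C : ℕ) (R : DataStructure (List ℕ)) (prog : Cmd (CaseBArr ⊕ P.Arr ⊕ R.Arr)),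
      IsRMQStructure A C R ∧
      ∀ (α : Type*) [LinearOrder α] (T : ℕ → α) (n k w : ℕ),
        1 ≤ n → k ∈ Finset.Icc 1 n → WordSizeOK A n w →
        (caseBStructure α P R prog).HasSpace w (T, n, k) (C * numRuns T n) ∧
        ∀ b e : ℕ, 1 ≤ b → b ≤ e → e ≤ n → CaseB T n b e →
          (caseBStructure α P R prog).Answers w (T, n, k) [b, e, k]
            (C * (1 + Q (numRuns T n) n)) (IsRMTQAnswer (suffixArray T n) b e k) := by
  have hR := RangeMax.isRMQStructure hA
  -- With range maximum constant `40`, space needs `6 + c + 40` words per run, and time `2 * Q + 80`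
  -- is at most `80 * (1 + Q)`; `80 + c` covers both.
  refine ⟨80 + c, RangeMax.dataStructure, CaseBQuery.prog P RangeMax.dataStructure,
    hR.mono (by omega), fun α _ T n k w hn hk hw => ⟨?_, fun b e hb hbe he hB => ?_⟩⟩
  · exact (CaseBQuery.hasSpace hP hR hw hn).mono (Nat.mul_le_mul_right _ (by omega))
  · refine (CaseBQuery.answers hA hP hR hw (Finset.mem_Icc.1 hk).2 hb hbe he hB).mono ?_
    have : 80 * (1 + Q (numRuns T n) n) ≤ (80 + c) * (1 + Q (numRuns T n) n) :=
      Nat.mul_le_mul_right _ (by omega)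
    omega
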